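/- \textbf{Theorem (second-order derivatives).} Let $\mathcal S$ be the set of positive-definite symmetric real $4\times4$ matrices with all diagonal entries equal to $1$. A matrix in $\mathcal S$ is identified with its six off-diagonal entries $\Lambda_{kl}=\Lambda_{lk}$, $k<l$, so that $\mathcal S$ is an open subset of $\mathbb R^6$; partial derivatives are taken in these coordinates, and $\Lambda_{kl}$, $\Lambda_{lk}$ denote the same variable. For $\Lambda\in\mathcal S$ let $X^\Lambda=(X_1,X_2,X_3,X_4)$ be a centered Gaussian vector with covariance matrix $\Lambda$, and put $$F(\Lambda)=E[\max(X_1,X_2,X_3,X_4)],\qquad \tilde A=6\sqrt2\,\mathcal V,$$ where $\mathcal V$ is the volume of the tetrahedron with vertices $X_1,X_2,X_3,X_4$ in $L^2$. For $k\neq l$ put $\Lambda'_{kl}=1-\Lambda_{kl}$ and $$\tilde\Lambda_{kl}=(1-\Lambda_{kl}+\Lambda_{kn}-\Lambda_{ln})(1-\Lambda_{kl}+\Lambda_{km}-\Lambda_{lm})-2(1-\Lambda_{kl})(1-\Lambda_{lm}-\Lambda_{ln}+\Lambda_{mn}),$$ where $m<n$ are the two elements of $\{1,2,3,4\}\setminus\{k,l\}$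 (one has $\tilde\Lambda_{kl}=\tilde\Lambda_{lk}$). Then for every $\Lambda\in\mathcal S$ and all pairwise distinct $k,l,m,n\in\{1,2,3,4\}$ (in any order) the following second-order partial derivatives exist and are given by $$\frac{\partial^2F}{\partial\Lambda_{kl}^2}(\Lambda)=-\frac1{8\sqrt{\pi^3(\Lambda'_{kl})^3}}\arccos\!\left(\frac{\tilde\Lambda_{kl}}{\sqrt{\Lambda'_{kl}\tilde A^2+\tilde\Lambda_{kl}^2}}\right)+\frac1{4\sqrt{\pi^3}\,\Lambda'_{kl}\tilde A}\left[\frac{\tilde\Lambda_{km}(\Lambda'_{kl}+\Lambda'_{lm}-\Lambda'_{km})}{4\Lambda'_{kl}\Lambda'_{lm}-(\Lambda'_{kl}+\Lambda'_{lm}-\Lambda'_{km})^2}+\frac{\tilde\Lambda_{kn}(\Lambda'_{kl}+\Lambda'_{ln}-\Lambda'_{kn})}{4\Lambda'_{kl}\Lambda'_{ln}-(\Lambda'_{kl}+\Lambda'_{ln}-\Lambda'_{kn})^2}\right],$$ $$\frac{\partial^2F}{\partial\Lambda_{kl}\partial\Lambda_{km}}(\Lambda)=-\frac{\tilde\Lambda_{lm}}{2\sqrt{\pi^3}\,\tilde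 A\,\{4\Lambda'_{kl}\Lambda'_{lm}-(\Lambda'_{kl}+\Lambda'_{lm}-\Lambda'_{km})^2\}},$$ $$\frac{\partial^2F}{\partial\Lambda_{kl}\partial\Lambda_{mn}}(\Lambda)=-\frac1{2\sqrt{\pi^3}\,\tilde A}.$$ -/

import Mathlib

open MeasureTheory ProbabilityTheory
open scoped Topology

noncomputable section

namespace GaussianMax

/-- The set `𝒮` of positive-definite symmetric real `4 × 4` matrices with unit diagonal. -/
def S : Set (Matrix (Fin 4) (Fin 4) ℝ) :=
  {L | L.PosDef ∧ ∀ i, L i i = 1}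

/-- The centered Gaussian law on `ℝ⁴` with covariance matrix `L`. -/
abbrev law (L : Matrix (Fin 4) (Fin 4) ℝ) : Measure (EuclideanSpace ℝ (Fin 4)) :=
  multivariateGaussian 0 L

/-- The largest coordinate of a vector of `ℝ⁴`. -/
def maxCoord (x : Fin 4 → ℝ) : ℝ := Finset.univ.sup' Finset.univ_nonempty x

/-- `F(Λ) = E[max(X₁, X₂, X₃, X₄)]`, where `X` is a centered Gaussian vector with
covariance matrix `Λ`; here `X` is the identity on `ℝ⁴` with its law. -/
def F (L : Matrix (Fin 4) (Fin 4) ℝ) : ℝ := ∫ x, maxCoord (fun i => x i) ∂(law L)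

/-- `F(Λ)` does not depend on the choice of the Gaussian vector with covariance matrix `Λ`. -/
theorem F_eq_integral {Ω : Type*} [MeasurableSpace Ω] {P : Measure Ω} [IsProbabilityMeasure P]
    {L : Matrix (Fin 4) (Fin 4) ℝ} (hL : L.PosSemidef) {X : Ω → EuclideanSpace ℝ (Fin 4)}
    (hX : HasGaussianLaw X P) (hmean : ∀ i, ∫ ω, X ω i ∂P = 0)
    (hcov : ∀ i j, cov[fun ω => X ω i, fun ω => X ω j; P] = L i j) :
    ∫ ω, maxCoord (fun i => X ω i) ∂P = F L := by
  have hmeas : Continuous (fun x : EuclideanSpace ℝ (Fin 4) => maxCoord (fun i => x i)) := by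
    unfold maxCoord
    exact Continuous.finset_sup'_apply _ fun i _ => by fun_prop
  have : IsGaussian (P.map X) := hX.isGaussian_map
  have hXm : AEMeasurable X P := hX.aemeasurable
  have hint : Integrable X P := hX.integrable
  have hlaw : P.map X = law L := by
    apply IsGaussian.ext
    · simp only [law, id_eq, integral_id_multivariateGaussian]
      rw [integral_map hXm (by fun_prop)]
      ext i
      have h := (EuclideanSpace.proj (𝕜 := ℝ) i).integral_comp_comm hint
      simpa [hmean i] using h.symm
    rw [← ContinuousLinearMap.toBilinForm_inj]
    refine LinearMap.BilinForm.ext_basis (EuclideanSpace.basisFun (Fin 4) ℝ).toBasis fun i j => ?_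
    rw [ContinuousLinearMap.toBilinForm_apply, ContinuousLinearMap.toBilinForm_apply,
      covarianceBilin_apply_eq_cov IsGaussian.memLp_two_id,
      covarianceBilin_multivariateGaussian hL, covariance_map (by fun_prop) (by fun_prop) hXm]
    have h (i : Fin 4) : (fun u => inner ℝ ((EuclideanSpace.basisFun (Fin 4) ℝ).toBasis i) u) ∘ X
        = fun ω => X ω i := by
      ext; simp [PiLp.inner_apply]
    rw [h, h, hcov]
    simp
  rw [F, ← hlaw, integral_map hXm hmeas.aestronglyMeasurable]

theorem memLp_coord (L : Matrix (Fin 4) (Fin 4) ℝ) (i : Fin 4) :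
    MemLp (fun x : EuclideanSpace ℝ (Fin 4) => x i) 2 (law L) := by
  have h : MemLp (fun x : EuclideanSpace ℝ (Fin 4) => x) 2 (law L) :=
    IsGaussian.memLp_two_id
  exact (EuclideanSpace.proj (𝕜 := ℝ) i).comp_memLp' h

/-- The Gaussian random variable `X_i^Λ`, as a vector of `L²`. -/
def vertex (L : Matrix (Fin 4) (Fin 4) ℝ) (i : Fin 4) : Lp ℝ 2 (law L) :=
  (memLp_coord L i).toLp _

/-- The volume of the convex hull of four points of a real inner product space, i.e. its
three-dimensional Hausdorff measure, normalized to agree with Lebesgue measure on `ℝ³`. -/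
def tetraVolume {H : Type*} [NormedAddCommGroup H] [InnerProductSpace ℝ H]
    (v : Fin 4 → H) : ℝ :=
  letI : MeasurableSpace H := borel H
  haveI : BorelSpace H := ⟨rfl⟩
  (Measure.euclideanHausdorffMeasure 3 (convexHull ℝ (Set.range v))).toReal

/-- `Ã = 6√2 𝒱`, with `𝒱` the volume of the tetrahedron in `L²` with vertices
`X₁^Λ, X₂^Λ, X₃^Λ, X₄^Λ`. -/
def Atilde (L : Matrix (Fin 4) (Fin 4) ℝ) : ℝ := 6 * √2 * tetraVolume (vertex L)

/-- `(Λ')_{kl} = 1 - Λ_{kl}`. -/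
def prime (L : Matrix (Fin 4) (Fin 4) ℝ) (k l : Fin 4) : ℝ := 1 - L k l

/-- The smallest index other than `k` and `l`. -/
def minRest (k l : Fin 4) : Fin 4 :=
  (({k, l} : Finset (Fin 4))ᶜ).min' (by revert k l; decide)

/-- The largest index other than `k` and `l`. -/
def maxRest (k l : Fin 4) : Fin 4 :=
  (({k, l} : Finset (Fin 4))ᶜ).max' (by revert k l; decide)

/-- `(Λ̃)_{kl}`. -/
def tilde (L : Matrix (Fin 4) (Fin 4) ℝ) (k l : Fin 4) : ℝ :=
  let m := minRest k l
  let n := maxRest k l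
  (1 - L k l + L k n - L l n) * (1 - L k l + L k m - L l m)
    - 2 * (1 - L k l) * (1 - L l m - L l n + L m n)

/-- The direction in which the coordinate `Λ_{kl} = Λ_{lk}` (`k ≠ l`) of a symmetric matrix
is varied. -/
def dir (k l : Fin 4) : Matrix (Fin 4) (Fin 4) ℝ :=
  Matrix.single k l 1 + Matrix.single l k 1

/-- The partial derivative `∂G/∂Λ_{kl}` at `L` (with the value `0` if it does not exist). -/
def partialDeriv (G : Matrix (Fin 4) (Fin 4) ℝ → ℝ) (k l : Fin 4)
    (L : Matrix (Fin 4) (Fin 4) ℝ) : ℝ :=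
  deriv (fun t : ℝ => G (L + t • dir k l)) 0

/-- `∂²G/∂Λ_{kl}∂Λ_{mn}` exists at `L` and equals `v`: the partial derivative `∂G/∂Λ_{kl}`
exists at all points `L + t • dir m n` with `t` near `0`, and it has derivative `v` in `t`
at `t = 0`. -/
def HasSecondPartial (G : Matrix (Fin 4) (Fin 4) ℝ → ℝ) (k l m n : Fin 4) (v : ℝ)
    (L : Matrix (Fin 4) (Fin 4) ℝ) : Prop :=
  (∀ᶠ t in 𝓝 (0 : ℝ),
      DifferentiableAt ℝ (fun u : ℝ => G (L + t • dir m n + u • dir k l)) 0) ∧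
    HasDerivAt (fun t : ℝ => partialDeriv G k l (L + t • dir m n)) v 0

end GaussianMax

end

set_option linter.unusedSimpArgs false

noncomputable section

namespace GaussianMax

/-! ### Coordinates on three-dimensional Euclidean space -/

/-! The proof rests on a closed form: `F` equals `(2π)^(-3/2)` times the sum, over the six edges of
the tetrahedron, of edge length `√(2(1 - Λ_ij))` times exterior dihedral angle (`F_eq_sum_angle`).

To obtain it, subtract from the maximum the mean of the coordinates, which has expectation zero.
What remains is, on the event that `X_i` is largest, the average of the differences `X_i - X_p`. The
three nonzero differences form a nondegenerate Gaussian vector `y` with covariance `G`, and the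
event is the positive octant. There the linear form `(G⁻¹y)_0` times the density is minus a partial
derivative of the density, so its integral reduces to a Gaussian integral over the face `y_0 = 0`.
That quadrant integral is an arccosine, namely the dihedral angle at an edge
(`integral_octant_multivariateGaussian`). Doing this for each of the three edges at `i` gives a
linear system with matrix `adj G` for the three expected differences, and multiplying by `G` solves
it (`integral_winSet_eq`).

Differentiating the closed form in `Λ_kl` gives one term from the length of the edge `kl` and six
from the angles. By the Schläfli identity (`schlafli`) the six angle terms cancel, so the first
derivative is just a constant times angle over `√(1 - Λ_kl)` (`hasDerivAt_F`). A second derivative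
therefore needs only the derivative of a single angle: with respect to its own edge, an adjacent
edge or the opposite edge (`hasDerivAt_angle_self`, `hasDerivAt_angle_adjacent`,
`hasDerivAt_angle_opposite`). The volume enters through the Gram determinant in these derivatives
(`Atilde_eq`). -/

/-- The three coordinates of a vector of `ℝ³`. -/
def coords : EuclideanSpace ℝ (Fin 3) ≃ᵐ ℝ × ℝ × ℝ :=
  (MeasurableEquiv.toLp 2 (Fin 3 → ℝ)).symm.trans
    ((MeasurableEquiv.piFinSuccAbove (fun _ => ℝ) 0).trans
      ((MeasurableEquiv.refl ℝ).prodCongr MeasurableEquiv.finTwoArrow))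

theorem coords_apply (x : EuclideanSpace ℝ (Fin 3)) : coords x = (x 0, x 1, x 2) := rfl

theorem measurePreserving_coords : MeasurePreserving coords volume volume := by
  refine (EuclideanSpace.volume_preserving_symm_measurableEquiv_toLp (Fin 3)).trans ?_
  exact (volume_preserving_piFinSuccAbove (fun _ : Fin 3 => ℝ) 0).trans
    ((MeasurePreserving.id volume).prod (volume_preserving_finTwoArrow ℝ))

/-! ### The volume of a tetrahedron -/

theorem volume_triangle (s : ℝ) (hs : 0 ≤ s) :
    volume {p : ℝ × ℝ | 0 ≤ p.1 ∧ 0 ≤ p.2 ∧ p.1 + p.2 ≤ s} = ENNReal.ofReal (s ^ 2 / 2) := by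
  have hm : MeasurableSet {p : ℝ × ℝ | 0 ≤ p.1 ∧ 0 ≤ p.2 ∧ p.1 + p.2 ≤ s} := by
    measurability
  rw [Measure.volume_eq_prod, Measure.prod_apply hm]
  have h : ∀ y : ℝ, volume (Prod.mk y ⁻¹' {p : ℝ × ℝ | 0 ≤ p.1 ∧ 0 ≤ p.2 ∧ p.1 + p.2 ≤ s})
      = (Set.Icc 0 s).indicator (fun y => ENNReal.ofReal (s - y)) y := by
    intro y
    by_cases hy : y ∈ Set.Icc 0 s
    · rw [Set.indicator_of_mem hy, ← sub_zero (s - y), ← Real.volume_Icc]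
      congr 1; ext z
      simp only [Set.mem_preimage, Set.mem_ofPred_eq, Set.mem_Icc]
      exact ⟨fun h => ⟨h.2.1, by linarith⟩, fun h => ⟨hy.1, h.1, by linarith⟩⟩
    · rw [Set.indicator_of_notMem hy]
      convert measure_empty (μ := (volume : Measure ℝ))
      ext z
      simp only [Set.mem_preimage, Set.mem_ofPred_eq, Set.mem_empty_iff_false, iff_false]
      exact fun h => hy ⟨h.1, by linarith⟩
  simp_rw [h]
  rw [lintegral_indicator measurableSet_Icc, ← ofReal_integral_eq_lintegral_ofReal]
  · rw [integral_Icc_eq_integral_Ioc, ← intervalIntegral.integral_of_le hs]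
    congr 1
    rw [intervalIntegral.integral_comp_sub_left (fun x => x) s]
    simp
  · exact (by fun_prop : Continuous fun y : ℝ => s - y).integrableOn_Icc
  · filter_upwards [ae_restrict_mem measurableSet_Icc] with y hy
    simpa using hy.2

theorem volume_corner :
    volume {x : EuclideanSpace ℝ (Fin 3) | (∀ i, 0 ≤ x i) ∧ ∑ i, x i ≤ 1}
      = ENNReal.ofReal (1 / 6) := by
  set C : Set (ℝ × ℝ × ℝ) := {p | 0 ≤ p.1 ∧ 0 ≤ p.2.1 ∧ 0 ≤ p.2.2 ∧ p.1 + (p.2.1 + p.2.2) ≤ 1}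
  have hm : MeasurableSet C := by
    measurability
  have hC : {x : EuclideanSpace ℝ (Fin 3) | (∀ i, 0 ≤ x i) ∧ ∑ i, x i ≤ 1} = coords ⁻¹' C := by
    ext x
    simp only [Set.mem_ofPred_eq, Set.mem_preimage, coords_apply, C, Fin.forall_fin_succ,
      Fin.sum_univ_three]
    simp [and_assoc, add_assoc]
  rw [hC, measurePreserving_coords.measure_preimage hm.nullMeasurableSet,
    Measure.volume_eq_prod, Measure.prod_apply hm]
  have h : ∀ x : ℝ, volume (Prod.mk x ⁻¹' C)
      = (Set.Icc 0 1).indicator (fun x => ENNReal.ofReal ((1 - x) ^ 2 / 2)) x := by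
    intro x
    by_cases hx : x ∈ Set.Icc (0 : ℝ) 1
    · rw [Set.indicator_of_mem hx, ← volume_triangle _ (by linarith [hx.2])]
      congr 1; ext z
      simp only [Set.mem_preimage, Set.mem_ofPred_eq, C]
      exact ⟨fun h => ⟨h.2.1, h.2.2.1, by linarith⟩, fun h => ⟨hx.1, h.1, h.2.1, by linarith⟩⟩
    · rw [Set.indicator_of_notMem hx]
      convert measure_empty (μ := (volume : Measure (ℝ × ℝ)))
      ext z
      simp only [Set.mem_preimage, Set.mem_ofPred_eq, Set.mem_empty_iff_false, iff_false, C]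
      exact fun h => hx ⟨h.1, by linarith⟩
  simp_rw [h]
  rw [lintegral_indicator measurableSet_Icc, ← ofReal_integral_eq_lintegral_ofReal]
  · rw [integral_Icc_eq_integral_Ioc, ← intervalIntegral.integral_of_le zero_le_one]
    congr 1
    rw [intervalIntegral.integral_comp_sub_left (fun x => x ^ 2 / 2) 1]
    norm_num
  · exact (by fun_prop : Continuous fun y : ℝ => (1 - y) ^ 2 / 2).integrableOn_Icc
  · exact Filter.Eventually.of_forall fun y => by positivity

section Tetra

variable {H : Type*} [NormedAddCommGroup H] [InnerProductSpace ℝ H]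

/-- The linear map from `ℝ³` that takes the standard basis to the edges at the first vertex. -/
def edgeMap (v : Fin 4 → H) : EuclideanSpace ℝ (Fin 3) →ₗ[ℝ] H :=
  (EuclideanSpace.basisFun (Fin 3) ℝ).toBasis.constr ℝ fun i => v i.succ - v 0

theorem edgeMap_apply (v : Fin 4 → H) (x : EuclideanSpace ℝ (Fin 3)) :
    edgeMap v x = ∑ i, x i • (v i.succ - v 0) := by
  simp [edgeMap, Module.Basis.constr_apply_fintype]

theorem convexHull_eq_image_corner (v : Fin 4 → H) :
    convexHull ℝ (Set.range v) = (fun x => v 0 + x) ''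
      (edgeMap v '' {x : EuclideanSpace ℝ (Fin 3) | (∀ i, 0 ≤ x i) ∧ ∑ i, x i ≤ 1}) := by
  apply Set.Subset.antisymm
  · rw [Convex.convexHull_subset_iff]
    · rintro _ ⟨i, rfl⟩
      refine Fin.cases ?_ (fun j => ?_) i
      · exact ⟨0, ⟨0, by simp, by simp⟩, by simp⟩
      · refine ⟨_, ⟨EuclideanSpace.single j 1, ⟨fun i => ?_, ?_⟩, rfl⟩, ?_⟩
        · by_cases h : i = j <;> simp [h]
        · simp
        · simp [edgeMap_apply]
    · refine Convex.translate (Convex.linear_image ?_ _) _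
      rintro x ⟨hx, hx'⟩ y ⟨hy, hy'⟩ a b ha hb hab
      refine ⟨fun i => ?_, ?_⟩
      · have := hx i; have := hy i
        simp only [PiLp.add_apply, PiLp.smul_apply, smul_eq_mul]; positivity
      · simp only [PiLp.add_apply, PiLp.smul_apply, smul_eq_mul, Finset.sum_add_distrib,
          ← Finset.mul_sum]
        nlinarith
  · rintro _ ⟨_, ⟨x, ⟨hx, hx'⟩, rfl⟩, rfl⟩
    refine mem_convexHull_of_exists_fintype (Fin.cons (1 - ∑ i, x i) fun i => x i) v ?_ ?_
      (fun i => ⟨i, rfl⟩) ?_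
    · refine Fin.cases ?_ fun i => ?_
      · simpa using hx'
      · simpa using hx i
    · simp [Fin.sum_univ_succ (n := 3)]
    · simp only [Fin.sum_univ_succ (n := 3), edgeMap_apply, Fin.cons_zero, Fin.cons_succ, smul_sub,
        Finset.sum_sub_distrib, sub_smul, one_smul, Finset.sum_smul]
      abel

/-- The tetrahedron is a translate of the linear image of the standard corner of `ℝ³`. A linear map
scales three-dimensional Hausdorff measure by the square root of the Gram determinant of the images
of an orthonormal basis, and the corner has volume `1/6`. -/
theorem tetraVolume_eq (v : Fin 4 → H) :
    tetraVolume v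
      = √(Matrix.gram ℝ fun i : Fin 3 => v i.succ - v 0).det / 6 := by
  let _ : MeasurableSpace H := borel H
  have : BorelSpace H := ⟨rfl⟩
  have h := (edgeMap v).euclideanHausdorffMeasure_image_eq_normDet_mul_volume
    {x : EuclideanSpace ℝ (Fin 3) | (∀ i, 0 ≤ x i) ∧ ∑ i, x i ≤ 1}
  rw [finrank_euclideanSpace_fin, volume_corner] at h
  have hd := (edgeMap v).normDet_sq_eq_det_gram (EuclideanSpace.basisFun (Fin 3) ℝ)
  have hb : (fun i => edgeMap v (EuclideanSpace.basisFun (Fin 3) ℝ i))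
      = fun i : Fin 3 => v i.succ - v 0 := by
    ext i; simp [edgeMap_apply]
  rw [hb] at hd
  have h1 : tetraVolume v
      = (Measure.euclideanHausdorffMeasure 3 (convexHull ℝ (Set.range v))).toReal := rfl
  rw [h1, convexHull_eq_image_corner, (isometry_add_left (v 0)).euclideanHausdorffMeasure_image, h,
    ENNReal.toReal_mul,
    ENNReal.toReal_ofReal (LinearMap.normDet_nonneg _), ENNReal.toReal_ofReal (by norm_num),
    ← hd]
  simp [Real.sqrt_sq (LinearMap.normDet_nonneg _)]
  ring

end Tetra

theorem inner_vertex {L : Matrix (Fin 4) (Fin 4) ℝ} (hL : L.PosSemidef) (i j : Fin 4) :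
    inner ℝ (vertex L i) (vertex L j) = L i j := by
  have h0 (i : Fin 4) : ∫ x, x i ∂law L = 0 := by
    have hi : Integrable (fun x : EuclideanSpace ℝ (Fin 4) => x) (law L) :=
      IsGaussian.integrable_id
    have h := (EuclideanSpace.proj (𝕜 := ℝ) i).integral_comp_comm hi
    simpa using h
  rw [← covariance_eval_multivariateGaussian hL (μ := 0) i j,
    covariance_eq_sub (memLp_coord L i) (memLp_coord L j), L2.inner_def]
  rw [h0 i, zero_mul, sub_zero]
  refine integral_congr_ae ?_
  filter_upwards [(memLp_coord L i).coeFn_toLp, (memLp_coord L j).coeFn_toLp] with x hi hj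
  simp only [vertex, hi, hj, Pi.mul_apply]
  simp [mul_comm]

/-- The Gram determinant of the differences `X_j - X_i`, `X_a - X_i`, `X_b - X_i`. -/
def gramDet (L : Matrix (Fin 4) (Fin 4) ℝ) (i j a b : Fin 4) : ℝ :=
  let g := fun p q => L p q - L p i - L i q + L i i
  g j j * (g a a * g b b - g a b ^ 2) - g a j * (g a j * g b b - g a b * g b j)
    + g b j * (g a j * g a b - g a a * g b j)

theorem eq_or_of_ne {i j a b : Fin 4} (hij : i ≠ j) (hia : i ≠ a) (hib : i ≠ b) (hja : j ≠ a)
    (hjb : j ≠ b) (hab : a ≠ b) (p : Fin 4) : p = i ∨ p = j ∨ p = a ∨ p = b := by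
  omega

/-- The convex hull does not see the order of the vertices. Allowing every labelling lets Gram
determinants based at different vertices be replaced by the same `Atilde L`. -/
theorem Atilde_eq {L : Matrix (Fin 4) (Fin 4) ℝ} (hL : L.PosSemidef) {i j a b : Fin 4}
    (hij : i ≠ j) (hia : i ≠ a) (hib : i ≠ b) (hja : j ≠ a) (hjb : j ≠ b) (hab : a ≠ b) :
    Atilde L = √(2 * gramDet L i j a b) := by
  have hs (p q : Fin 4) : L p q = L q p := by simpa using congrFun₂ hL.1 q p
  have hsurj : Function.Surjective ![i, j, a, b] := fun p => by
    rcases eq_or_of_ne hij hia hib hja hjb hab p with rfl | rfl | rfl | rfl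
    exacts [⟨0, rfl⟩, ⟨1, rfl⟩, ⟨2, rfl⟩, ⟨3, rfl⟩]
  have hv : tetraVolume (vertex L) = tetraVolume (vertex L ∘ ![i, j, a, b]) := by
    rw [tetraVolume, tetraVolume, hsurj.range_comp]
  rw [Atilde, hv, tetraVolume_eq, Real.sqrt_mul (by norm_num)]
  have : (Matrix.gram ℝ fun p : Fin 3 =>
      (vertex L ∘ ![i, j, a, b]) p.succ - (vertex L ∘ ![i, j, a, b]) 0).det
      = gramDet L i j a b := by
    rw [Matrix.det_fin_three]
    simp only [Matrix.gram_apply, inner_sub_left, inner_sub_right, Function.comp_apply,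
      inner_vertex hL, gramDet]
    have h1 : (0 : Fin 3).succ = (1 : Fin 4) := rfl
    have h2 : (1 : Fin 3).succ = (2 : Fin 4) := rfl
    have h3 : (2 : Fin 3).succ = (3 : Fin 4) := rfl
    simp only [h1, h2, h3, Matrix.cons_val, hs j i, hs a i, hs b i, hs a j, hs b j, hs b a]
    ring
  rw [this]
  ring

/-! ### The density of a nondegenerate Gaussian law -/

section Density

variable {ι : Type*} [Fintype ι] [DecidableEq ι]

/-- Both sides are finite measures, so it suffices to compare characteristic functions; that of the
density is a complex Gaussian integral. -/
theorem stdGaussian_eq_withDensity {V : Type*} [NormedAddCommGroup V] [InnerProductSpace ℝ V]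
    [FiniteDimensional ℝ V] [MeasurableSpace V] [BorelSpace V] :
    stdGaussian V = volume.withDensity fun v =>
      ENNReal.ofReal (((2 * Real.pi) ^ (Module.finrank ℝ V / 2 : ℝ))⁻¹ * Real.exp (-‖v‖ ^ 2 / 2)) := by
  set c : ℝ := (2 * Real.pi) ^ (Module.finrank ℝ V / 2 : ℝ) with hc
  have hc0 : 0 < c := by positivity
  have hint : Integrable fun v : V => Real.exp (-‖v‖ ^ 2 / 2) := by
    -- The Bochner integral of a non-integrable function is `0` by convention, so the known nonzero
    -- value forces integrability.
    refine Integrable.of_integral_ne_zero ?_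
    have h := GaussianFourier.integral_rexp_neg_mul_sq_norm (V := V) (b := 1 / 2) (by norm_num)
    have h2 : ∫ v : V, Real.exp (-‖v‖ ^ 2 / 2) = (Real.pi / (1 / 2)) ^ (Module.finrank ℝ V / 2 : ℝ) := by
      rw [← h]; congr 1; ext v; ring_nf
    rw [h2]; positivity
  have : IsFiniteMeasure (volume.withDensity fun v : V =>
      ENNReal.ofReal (c⁻¹ * Real.exp (-‖v‖ ^ 2 / 2))) :=
    isFiniteMeasure_withDensity_ofReal (hint.const_mul _).2
  refine Measure.ext_of_charFun ?_
  ext t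
  rw [charFun_stdGaussian, charFun_apply, integral_withDensity_eq_integral_toReal_smul
    (by fun_prop) (by simp)]
  have h := GaussianFourier.integral_cexp_neg_mul_sq_norm_add (V := V) (b := 1 / 2) (by norm_num)
    Complex.I t
  have h1 : ∀ v : V, (ENNReal.ofReal (c⁻¹ * Real.exp (-‖v‖ ^ 2 / 2))).toReal •
      Complex.exp (inner ℝ v t * Complex.I) = (c : ℂ)⁻¹ *
        Complex.exp (-(1 / 2) * (‖v‖ : ℂ) ^ 2 + Complex.I * (inner ℝ t v : ℝ)) := by
    intro v
    rw [ENNReal.toReal_ofReal (by positivity), Complex.real_smul, Complex.exp_add,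
      real_inner_comm]
    push_cast
    rw [mul_assoc]
    congr 3
    · ring_nf
    · ring_nf
  simp_rw [h1]
  rw [integral_const_mul, h]
  have h2 : ((Real.pi : ℂ) / (1 / 2)) ^ ((Module.finrank ℝ V : ℂ) / 2) = (c : ℂ) := by
    rw [hc, Complex.ofReal_cpow (by positivity)]
    push_cast
    congr 1
    ring
  rw [h2, ← mul_assoc, inv_mul_cancel₀ (by exact_mod_cast hc0.ne'), one_mul]
  congr 1
  rw [Complex.I_sq]
  ring

/-- The density of the centered Gaussian law with covariance matrix `G`. -/
def gaussianDensity (G : Matrix ι ι ℝ) (x : EuclideanSpace ℝ ι) : ℝ :=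
  ((2 * Real.pi) ^ (Fintype.card ι / 2 : ℝ))⁻¹ * (√G.det)⁻¹ *
    Real.exp (-(x ⬝ᵥ G⁻¹.mulVec x) / 2)

theorem det_toEuclideanCLM (A : Matrix ι ι ℝ) :
    LinearMap.det (Matrix.toEuclideanCLM (𝕜 := ℝ) A).toLinearMap = A.det := by
  have : (Matrix.toEuclideanCLM (𝕜 := ℝ) A).toLinearMap
      = Matrix.toLin (EuclideanSpace.basisFun ι ℝ).toBasis (EuclideanSpace.basisFun ι ℝ).toBasis A := by
    rw [← Matrix.toEuclideanLin_eq_toLin_orthonormal]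
    ext; simp
  rw [this, LinearMap.det_toLin]

-- The law is the image of the standard Gaussian under `A = √G`. In the change of variables `x = Az`
-- the quadratic form of `G⁻¹` becomes `‖z‖²`, and the Jacobian `|det A|` is `√(det G)`.
open scoped MatrixOrder in
theorem multivariateGaussian_eq_withDensity {G : Matrix ι ι ℝ} (hG : G.PosDef) :
    multivariateGaussian 0 G = volume.withDensity fun x => ENNReal.ofReal (gaussianDensity G x) := by
  set A := CFC.sqrt G with hA
  have hAA : A * A = G := CFC.sqrt_mul_sqrt_self _ hG.posSemidef.nonneg
  have hAt : A.transpose = A := by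
    have h := (CFC.sqrt_nonneg G).isSelfAdjoint.star_eq
    rwa [Matrix.star_eq_conjTranspose, Matrix.conjTranspose_eq_transpose_of_trivial] at h
  have hdet : A.det * A.det = G.det := by rw [← Matrix.det_mul, hAA]
  have hG0 : 0 < G.det := hG.det_pos
  have hA0 : A.det ≠ 0 := fun h => by rw [h] at hdet; simp at hdet; exact hG0.ne hdet
  have hAu : IsUnit A.det := hA0.isUnit
  set T := Matrix.toEuclideanCLM (𝕜 := ℝ) A with hT
  have hT0 : LinearMap.det T.toLinearMap ≠ 0 := by rwa [hT, det_toEuclideanCLM]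
  have hinj : Function.Injective T :=
    (LinearMap.equivOfDetNeZero T.toLinearMap hT0).injective
  have hemb : MeasurableEmbedding T := T.continuous.measurableEmbedding hinj
  have hq (z : EuclideanSpace ℝ ι) : (T z) ⬝ᵥ G⁻¹.mulVec (T z) = ‖z‖ ^ 2 := by
    rw [hT, Matrix.ofLp_toEuclideanCLM, ← hAA, Matrix.mul_inv_rev, ← Matrix.mulVec_mulVec,
      Matrix.mulVec_mulVec _ A⁻¹ A, Matrix.nonsing_inv_mul _ hAu, Matrix.one_mulVec,
      Matrix.dotProduct_mulVec, ← Matrix.mulVec_transpose, Matrix.transpose_nonsing_inv, hAt,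
      Matrix.mulVec_mulVec, Matrix.nonsing_inv_mul _ hAu, Matrix.one_mulVec,
      EuclideanSpace.real_norm_sq_eq, dotProduct]
    simp [sq]
  have hmap := Measure.map_linearMap_addHaar_eq_smul_addHaar volume hT0
  rw [multivariateGaussian]
  simp only [zero_add]
  rw [stdGaussian_eq_withDensity]
  ext s hs
  rw [Measure.map_apply (by fun_prop) hs, withDensity_apply _ (by exact hemb.measurable hs),
    withDensity_apply _ hs]
  have hscale : (volume : Measure (EuclideanSpace ℝ ι))
      = ENNReal.ofReal |A.det| • Measure.map T volume := by
    have h := hmap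
    rw [det_toEuclideanCLM] at h
    change Measure.map T volume = _ at h
    rw [h, smul_smul, ← ENNReal.ofReal_mul (abs_nonneg _), ← abs_mul, mul_inv_cancel₀ hA0]
    simp
  conv_rhs =>
    rw [hscale, Measure.restrict_smul, lintegral_smul_measure, hemb.restrict_map,
      hemb.lintegral_map, smul_eq_mul, ← lintegral_const_mul' _ _ ENNReal.ofReal_ne_top]
  refine lintegral_congr fun z => ?_
  rw [← ENNReal.ofReal_mul (abs_nonneg _), gaussianDensity, hq, finrank_euclideanSpace, ← hdet,
    Real.sqrt_mul_self_eq_abs]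
  congr 1
  field_simp

theorem gaussianDensity_nonneg (G : Matrix ι ι ℝ) (x : EuclideanSpace ℝ ι) :
    0 ≤ gaussianDensity G x := by
  unfold gaussianDensity; positivity

theorem continuous_gaussianDensity (G : Matrix ι ι ℝ) : Continuous (gaussianDensity G) := by
  unfold gaussianDensity dotProduct Matrix.mulVec dotProduct
  fun_prop

theorem integral_multivariateGaussian {G : Matrix ι ι ℝ} (hG : G.PosDef)
    (f : EuclideanSpace ℝ ι → ℝ) :
    ∫ x, f x ∂(multivariateGaussian 0 G) = ∫ x, gaussianDensity G x * f x := by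
  rw [multivariateGaussian_eq_withDensity hG, integral_withDensity_eq_integral_toReal_smul
    (by have := continuous_gaussianDensity G; fun_prop) (by simp)]
  simp [ENNReal.toReal_ofReal (gaussianDensity_nonneg G _)]

theorem integrable_multivariateGaussian_iff {G : Matrix ι ι ℝ} (hG : G.PosDef)
    (f : EuclideanSpace ℝ ι → ℝ) :
    Integrable f (multivariateGaussian 0 G) ↔ Integrable fun x => gaussianDensity G x * f x := by
  rw [multivariateGaussian_eq_withDensity hG, integrable_withDensity_iff_integrable_smul'
    (by have := continuous_gaussianDensity G; fun_prop) (by simp)]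
  simp [ENNReal.toReal_ofReal (gaussianDensity_nonneg G _)]

end Density

/-- A centered Gaussian vector has the law determined by its covariance matrix. -/
theorem map_eq_multivariateGaussian {ι Ω : Type*} [Fintype ι] [DecidableEq ι] [MeasurableSpace Ω]
    {P : Measure Ω} [IsProbabilityMeasure P] {G : Matrix ι ι ℝ} (hG : G.PosSemidef)
    {X : Ω → EuclideanSpace ℝ ι} (hX : HasGaussianLaw X P) (hmean : ∀ i, ∫ ω, X ω i ∂P = 0)
    (hcov : ∀ i j, cov[fun ω => X ω i, fun ω => X ω j; P] = G i j) :
    P.map X = multivariateGaussian 0 G := by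
  have : IsGaussian (P.map X) := hX.isGaussian_map
  have hXm : AEMeasurable X P := hX.aemeasurable
  have hint : Integrable X P := hX.integrable
  apply IsGaussian.ext
  · simp only [id_eq, integral_id_multivariateGaussian]
    rw [integral_map hXm (by fun_prop)]
    ext i
    have h := (EuclideanSpace.proj (𝕜 := ℝ) i).integral_comp_comm hint
    simpa [hmean i] using h.symm
  rw [← ContinuousLinearMap.toBilinForm_inj]
  refine LinearMap.BilinForm.ext_basis (EuclideanSpace.basisFun ι ℝ).toBasis fun i j => ?_
  rw [ContinuousLinearMap.toBilinForm_apply, ContinuousLinearMap.toBilinForm_apply,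
    covarianceBilin_apply_eq_cov IsGaussian.memLp_two_id,
    covarianceBilin_multivariateGaussian hG, covariance_map (by fun_prop) (by fun_prop) hXm]
  have h (i : ι) : (fun u => inner ℝ ((EuclideanSpace.basisFun ι ℝ).toBasis i) u) ∘ X
      = fun ω => X ω i := by
    ext; simp [PiLp.inner_apply]
  rw [h, h, hcov]
  simp

/-! ### Gaussian integrals over a quadrant and an octant -/

theorem quad_pos {a b c : ℝ} (ha : 0 < a) (h : b ^ 2 < a * c) (t : ℝ) :
    0 < a + 2 * b * t + c * t ^ 2 := by
  rcases eq_or_ne t 0 with rfl | ht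
  · simpa using ha
  · have h1 : 0 < (a * c - b ^ 2) * t ^ 2 := mul_pos (by linarith) (by positivity)
    -- Complete the square: `a` times the polynomial is `(a + bt)² + (ac - b²)t²`.
    refine pos_of_mul_pos_right ?_ ha.le
    nlinarith [sq_nonneg (a + b * t)]

/-- With `d² = ac - b²`, an antiderivative is `arctan((ct + b)/d)/d`. The value at `0` becomes an
arcsine because `d² + b² = ac`, and `π/2 - arcsin = arccos`. -/
theorem integral_inv_quad {a b c : ℝ} (ha : 0 < a) (hc : 0 < c) (h : b ^ 2 < a * c) :
    IntegrableOn (fun t => (a + 2 * b * t + c * t ^ 2)⁻¹) (Set.Ioi 0) ∧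
    ∫ t in Set.Ioi 0, (a + 2 * b * t + c * t ^ 2)⁻¹
      = Real.arccos (b / √(a * c)) / √(a * c - b ^ 2) := by
  set d := √(a * c - b ^ 2) with hd
  have hd0 : 0 < d := Real.sqrt_pos.2 (by linarith)
  have hd2 : d ^ 2 = a * c - b ^ 2 := Real.sq_sqrt (by linarith)
  have hder (t : ℝ) : HasDerivAt (fun t => d⁻¹ * Real.arctan ((c * t + b) / d))
      (a + 2 * b * t + c * t ^ 2)⁻¹ t := by
    have h1 : HasDerivAt (fun t : ℝ => (c * t + b) / d) (c / d) t := by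
      simpa using (((hasDerivAt_id t).const_mul c).add_const b).div_const d
    convert! (h1.arctan.const_mul d⁻¹) using 1
    have hq := quad_pos ha h t
    have h3 : d ^ 2 + (c * t + b) ^ 2 = c * (a + 2 * b * t + c * t ^ 2) := by rw [hd2]; ring
    have h4 : 1 + ((c * t + b) / d) ^ 2 = c * (a + 2 * b * t + c * t ^ 2) / d ^ 2 := by
      rw [← h3]; field_simp
    rw [h4]
    field_simp
  have hcont : ContinuousWithinAt (fun t => d⁻¹ * Real.arctan ((c * t + b) / d)) (Set.Ici 0) 0 :=
    (hder 0).continuousAt.continuousWithinAt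
  have hpos : ∀ t ∈ Set.Ioi (0 : ℝ), 0 ≤ (a + 2 * b * t + c * t ^ 2)⁻¹ := fun t _ =>
    (inv_pos.2 (quad_pos ha h t)).le
  have hlim : Filter.Tendsto (fun t => d⁻¹ * Real.arctan ((c * t + b) / d)) Filter.atTop
      (𝓝 (d⁻¹ * (Real.pi / 2))) := by
    refine Filter.Tendsto.const_mul _ ?_
    refine (Real.tendsto_arctan_atTop.mono_right nhdsWithin_le_nhds).comp ?_
    exact (Filter.tendsto_atTop_add_const_right _ _
      (Filter.tendsto_id.const_mul_atTop hc)).atTop_div_const hd0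
  refine ⟨integrableOn_Ioi_deriv_of_nonneg hcont (fun t _ => hder t) hpos hlim, ?_⟩
  rw [integral_Ioi_of_hasDerivAt_of_nonneg hcont (fun t _ => hder t) hpos hlim, Real.arccos,
    Real.arctan_eq_arcsin]
  have : (c * 0 + b) / d / √(1 + ((c * 0 + b) / d) ^ 2) = b / √(a * c) := by
    have h5 : √(1 + ((c * 0 + b) / d) ^ 2) = √(a * c) / d := by
      rw [← Real.sqrt_sq hd0.le, ← Real.sqrt_div' _ (sq_nonneg d), Real.sqrt_sq hd0.le]
      congr 1
      field_simp
      rw [hd2]; ring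
    rw [h5, mul_zero, zero_add, div_div_div_cancel_right₀ hd0.ne']
  rw [this]
  field_simp

theorem integral_mul_exp_neg_sq {q : ℝ} (hq : 0 < q) :
    IntegrableOn (fun y => y * Real.exp (-(y ^ 2 * q) / 2)) (Set.Ioi 0) ∧
    ∫ y in Set.Ioi 0, y * Real.exp (-(y ^ 2 * q) / 2) = q⁻¹ := by
  have hder (y : ℝ) : HasDerivAt (fun y => -q⁻¹ * Real.exp (-(y ^ 2 * q) / 2))
      (y * Real.exp (-(y ^ 2 * q) / 2)) y := by
    have h1 : HasDerivAt (fun y : ℝ => -(y ^ 2 * q) / 2) (-(2 * y * q) / 2) y := by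
      simpa using (((hasDerivAt_pow 2 y).mul_const q).neg).div_const 2
    convert! h1.exp.const_mul (-q⁻¹) using 1
    field_simp
  have hcont : ContinuousWithinAt (fun y => -q⁻¹ * Real.exp (-(y ^ 2 * q) / 2)) (Set.Ici 0) 0 :=
    (hder 0).continuousAt.continuousWithinAt
  have hpos : ∀ y ∈ Set.Ioi (0 : ℝ), 0 ≤ y * Real.exp (-(y ^ 2 * q) / 2) := fun y hy =>
    mul_nonneg (le_of_lt hy) (Real.exp_pos _).le
  have hlim : Filter.Tendsto (fun y => -q⁻¹ * Real.exp (-(y ^ 2 * q) / 2)) Filter.atTop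
      (𝓝 (-q⁻¹ * 0)) := by
    refine Filter.Tendsto.const_mul _ (Real.tendsto_exp_atBot.comp ?_)
    have : (fun y : ℝ => -(y ^ 2 * q) / 2) = fun y => (-q / 2) * y ^ 2 := by ext y; ring
    rw [this]
    exact (Filter.tendsto_pow_atTop two_ne_zero).const_mul_atTop_of_neg (by linarith)
  refine ⟨integrableOn_Ioi_deriv_of_nonneg hcont (fun t _ => hder t) hpos hlim, ?_⟩
  rw [integral_Ioi_of_hasDerivAt_of_nonneg hcont (fun t _ => hder t) hpos hlim]
  simp

/-- Use the slope `t = z/y` as a coordinate. By homogeneity the exponent is `y²` times a quadratic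
in `t`, the Jacobian is `y`, and integrating out `y` leaves the reciprocal of that quadratic. -/
theorem integral_quadrant {a b c : ℝ} (ha : 0 < a) (hc : 0 < c) (h : b ^ 2 < a * c) :
    ∫ y in Set.Ioi 0, ∫ z in Set.Ioi 0, Real.exp (-(a * y ^ 2 + 2 * b * y * z + c * z ^ 2) / 2)
      = Real.arccos (b / √(a * c)) / √(a * c - b ^ 2) := by
  have h1 : ∀ y ∈ Set.Ioi (0 : ℝ),
      ∫ z in Set.Ioi 0, Real.exp (-(a * y ^ 2 + 2 * b * y * z + c * z ^ 2) / 2)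
        = ∫ t in Set.Ioi 0, y * Real.exp (-(y ^ 2 * (a + 2 * b * t + c * t ^ 2)) / 2) := by
    intro y hy
    have hy0 : (0 : ℝ) < y := hy
    have := integral_comp_mul_left_Ioi
      (fun z => Real.exp (-(a * y ^ 2 + 2 * b * y * z + c * z ^ 2) / 2)) 0 hy0
    rw [mul_zero, smul_eq_mul, eq_inv_mul_iff_mul_eq₀ hy0.ne'] at this
    rw [← this, ← integral_const_mul]
    congr 1; ext t; congr 2; ring
  rw [setIntegral_congr_fun measurableSet_Ioi h1, integral_integral_swap]
  · rw [← (integral_inv_quad ha hc h).2]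
    congr 1; ext t
    exact (integral_mul_exp_neg_sq (quad_pos ha h t)).2
  · rw [integrable_prod_iff']
    · refine ⟨Filter.Eventually.of_forall fun t =>
        (integral_mul_exp_neg_sq (quad_pos ha h t)).1, ?_⟩
      refine (integral_inv_quad ha hc h).1.congr (Filter.Eventually.of_forall fun t => ?_)
      refine (integral_mul_exp_neg_sq (quad_pos ha h t)).2.symm.trans ?_
      refine setIntegral_congr_fun measurableSet_Ioi fun y hy => ?_
      have hy0 : (0 : ℝ) < y := hy
      exact (Real.norm_of_nonneg (by positivity)).symm
    · refine Continuous.aestronglyMeasurable ?_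
      unfold Function.uncurry
      fun_prop

theorem integral_exp_quad_deriv {a b c : ℝ} (ha : 0 < a)
    (hint : IntegrableOn (fun x => (a * x + b) * Real.exp (-(a * x ^ 2 + 2 * b * x + c) / 2))
      (Set.Ioi 0)) :
    ∫ x in Set.Ioi 0, (a * x + b) * Real.exp (-(a * x ^ 2 + 2 * b * x + c) / 2)
      = Real.exp (-c / 2) := by
  have hder (x : ℝ) : HasDerivAt (fun x => -Real.exp (-(a * x ^ 2 + 2 * b * x + c) / 2))
      ((a * x + b) * Real.exp (-(a * x ^ 2 + 2 * b * x + c) / 2)) x := by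
    have h1 : HasDerivAt (fun x : ℝ => -(a * x ^ 2 + 2 * b * x + c) / 2)
        (-(a * (2 * x) + 2 * b) / 2) x := by
      simpa using (((((hasDerivAt_pow 2 x).const_mul a).add
        ((hasDerivAt_id x).const_mul (2 * b))).add_const c).neg).div_const 2
    convert! h1.exp.neg using 1
    ring
  have hlim : Filter.Tendsto (fun x => -Real.exp (-(a * x ^ 2 + 2 * b * x + c) / 2)) Filter.atTop
      (𝓝 (-0)) := by
    refine Filter.Tendsto.neg (Real.tendsto_exp_atBot.comp ?_)
    have : (fun x : ℝ => -(a * x ^ 2 + 2 * b * x + c) / 2)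
        = fun x => x * (x * (-a / 2) + -b) + -c / 2 := by ext y; ring
    rw [this]
    refine Filter.tendsto_atBot_add_const_right _ _ (Filter.tendsto_id.atTop_mul_atBot₀ ?_)
    exact Filter.tendsto_atBot_add_const_right _ _
      (Filter.tendsto_id.atTop_mul_const_of_neg (by linarith))
  rw [integral_Ioi_of_hasDerivAt_of_tendsto (hder 0).continuousAt.continuousWithinAt
    (fun x _ => hder x) hint hlim]
  simp

/-- Integration by parts over the positive octant. -/
theorem integral_octant {a b c p q r : ℝ} (hp : 0 < p) (ha : 0 < a) (hc : 0 < c)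
    (h : b ^ 2 < a * c)
    (hint : IntegrableOn (fun v : ℝ × ℝ × ℝ => (p * v.1 + (q * v.2.1 + r * v.2.2)) *
      Real.exp (-(p * v.1 ^ 2 + 2 * (q * v.2.1 + r * v.2.2) * v.1
        + (a * v.2.1 ^ 2 + 2 * b * v.2.1 * v.2.2 + c * v.2.2 ^ 2)) / 2))
      (Set.Ioi 0 ×ˢ (Set.Ioi 0 ×ˢ Set.Ioi 0))) :
    ∫ v in Set.Ioi (0 : ℝ) ×ˢ (Set.Ioi (0 : ℝ) ×ˢ Set.Ioi (0 : ℝ)),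
      (p * v.1 + (q * v.2.1 + r * v.2.2)) *
      Real.exp (-(p * v.1 ^ 2 + 2 * (q * v.2.1 + r * v.2.2) * v.1
        + (a * v.2.1 ^ 2 + 2 * b * v.2.1 * v.2.2 + c * v.2.2 ^ 2)) / 2)
      = Real.arccos (b / √(a * c)) / √(a * c - b ^ 2) := by
  rw [IntegrableOn, Measure.volume_eq_prod, ← Measure.prod_restrict] at hint
  -- Integrate over the first variable first: the linear factor is half the derivative of the
  -- quadratic form in that variable, so only the boundary term at `0` survives.
  rw [Measure.volume_eq_prod, ← Measure.prod_restrict, integral_prod_symm _ hint]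
  have hae := hint.prod_left_ae
  have hcongr : ∀ᵐ w : ℝ × ℝ ∂volume.restrict (Set.Ioi 0 ×ˢ Set.Ioi 0),
      ∫ x in Set.Ioi (0 : ℝ), (p * x + (q * w.1 + r * w.2)) *
        Real.exp (-(p * x ^ 2 + 2 * (q * w.1 + r * w.2) * x
        + (a * w.1 ^ 2 + 2 * b * w.1 * w.2 + c * w.2 ^ 2)) / 2)
      = Real.exp (-(a * w.1 ^ 2 + 2 * b * w.1 * w.2 + c * w.2 ^ 2) / 2) := by
    filter_upwards [hae] with w hw
    exact integral_exp_quad_deriv hp hw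
  have hint2 := hint.integral_prod_right.congr hcongr
  rw [integral_congr_ae hcongr, ← integral_quadrant ha hc h]
  rw [Measure.volume_eq_prod, ← Measure.prod_restrict] at hint2 ⊢
  exact integral_prod _ hint2

/-! ### Differences of the coordinates -/

theorem integrable_coord {ι : Type*} [Fintype ι] [DecidableEq ι] (G : Matrix ι ι ℝ) (i : ι) :
    Integrable (fun x : EuclideanSpace ℝ ι => x i) (multivariateGaussian 0 G) := by
  have hi : Integrable (fun x : EuclideanSpace ℝ ι => x) (multivariateGaussian 0 G) :=
    IsGaussian.integrable_id
  exact (EuclideanSpace.proj (𝕜 := ℝ) i).integrable_comp hi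

theorem integral_coord {ι : Type*} [Fintype ι] [DecidableEq ι] (G : Matrix ι ι ℝ) (i : ι) :
    ∫ x, x i ∂multivariateGaussian 0 G = 0 := by
  have hi : Integrable (fun x : EuclideanSpace ℝ ι => x) (multivariateGaussian 0 G) :=
    IsGaussian.integrable_id
  have h := (EuclideanSpace.proj (𝕜 := ℝ) i).integral_comp_comm hi
  simpa using h

/-- The set of vectors of `ℝ³` with positive coordinates. -/
def octant : Set (EuclideanSpace ℝ (Fin 3)) :=
  coords ⁻¹' (Set.Ioi 0 ×ˢ (Set.Ioi 0 ×ˢ Set.Ioi 0))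

theorem measurableSet_octant : MeasurableSet octant :=
  coords.measurable (measurableSet_Ioi.prod (measurableSet_Ioi.prod measurableSet_Ioi))

theorem mem_octant {x : EuclideanSpace ℝ (Fin 3)} : x ∈ octant ↔ 0 < x 0 ∧ 0 < x 1 ∧ 0 < x 2 :=
  Iff.rfl

/-- The integrand is `det G · (G⁻¹y)_0`, and its product with the density is `-det G` times the
derivative of the density in `y_0`. Integration by parts leaves the quadrant integral on `y_0 = 0`.
-/
theorem integral_octant_multivariateGaussian {G : Matrix (Fin 3) (Fin 3) ℝ} (hG : G.PosDef) :
    ∫ y in octant, (G.adjugate 0 0 * y 0 + G.adjugate 0 1 * y 1 + G.adjugate 0 2 * y 2)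
        ∂multivariateGaussian 0 G
      = G.det * ((2 * Real.pi) ^ (3 / 2 : ℝ))⁻¹ *
        (Real.arccos (G.adjugate 1 2 / √(G.adjugate 1 1 * G.adjugate 2 2)) / √(G 0 0)) := by
  have hd : 0 < G.det := hG.det_pos
  have hP : G⁻¹.PosDef := hG.inv
  have hPe (r s : Fin 3) : G⁻¹ r s = G.adjugate r s / G.det := by
    rw [Matrix.inv_def, Matrix.smul_apply, Ring.inverse_eq_inv', smul_eq_mul]; ring
  have hsymm (r s : Fin 3) : G r s = G s r := by simpa using congrFun₂ hG.1 s r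
  have hPs (r s : Fin 3) : G⁻¹ r s = G⁻¹ s r := by simpa using congrFun₂ hP.1 s r
  have hA0 : 0 < G⁻¹ 0 0 := hP.diag_pos
  have hA1 : 0 < G⁻¹ 1 1 := hP.diag_pos
  have hA2 : 0 < G⁻¹ 2 2 := hP.diag_pos
  have hG0 : 0 < G 0 0 := hG.diag_pos
  -- Jacobi's identity for complementary minors of the inverse.
  have hminor : G⁻¹ 1 1 * G⁻¹ 2 2 - G⁻¹ 1 2 ^ 2 = G 0 0 / G.det := by
    simp only [hPe]
    field_simp
    rw [Matrix.adjugate_fin_three, Matrix.det_fin_three, hsymm 1 0, hsymm 2 0, hsymm 2 1]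
    simp
    ring
  have h12 : G⁻¹ 1 2 ^ 2 < G⁻¹ 1 1 * G⁻¹ 2 2 := by
    have : 0 < G 0 0 / G.det := by positivity
    linarith
  set f : ℝ × ℝ × ℝ → ℝ := fun v => (G⁻¹ 0 0 * v.1 + (G⁻¹ 0 1 * v.2.1 + G⁻¹ 0 2 * v.2.2)) *
      Real.exp (-(G⁻¹ 0 0 * v.1 ^ 2 + 2 * (G⁻¹ 0 1 * v.2.1 + G⁻¹ 0 2 * v.2.2) * v.1
        + (G⁻¹ 1 1 * v.2.1 ^ 2 + 2 * G⁻¹ 1 2 * v.2.1 * v.2.2 + G⁻¹ 2 2 * v.2.2 ^ 2)) / 2) with hf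
  have hc : (0 : ℝ) < (2 * Real.pi) ^ (3 / 2 : ℝ) := by positivity
  have hfy (y : EuclideanSpace ℝ (Fin 3)) : gaussianDensity G y *
      (G.adjugate 0 0 * y 0 + G.adjugate 0 1 * y 1 + G.adjugate 0 2 * y 2)
      = (√G.det * ((2 * Real.pi) ^ (3 / 2 : ℝ))⁻¹) * f (coords y) := by
    have hq : y.ofLp ⬝ᵥ G⁻¹.mulVec y.ofLp = G⁻¹ 0 0 * y 0 ^ 2
        + 2 * (G⁻¹ 0 1 * y 1 + G⁻¹ 0 2 * y 2) * y 0
        + (G⁻¹ 1 1 * y 1 ^ 2 + 2 * G⁻¹ 1 2 * y 1 * y 2 + G⁻¹ 2 2 * y 2 ^ 2) := by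
      simp only [dotProduct, Matrix.mulVec, Fin.sum_univ_three]
      rw [hPs 1 0, hPs 2 0, hPs 2 1]
      ring
    have hl : G.adjugate 0 0 * y 0 + G.adjugate 0 1 * y 1 + G.adjugate 0 2 * y 2
        = √G.det * √G.det * (G⁻¹ 0 0 * y 0 + (G⁻¹ 0 1 * y 1 + G⁻¹ 0 2 * y 2)) := by
      rw [Real.mul_self_sqrt hd.le]
      simp only [hPe]; field_simp; ring
    rw [hl, gaussianDensity, hq, hf]
    simp only [coords_apply, Fintype.card_fin]
    have := Real.sqrt_pos.2 hd
    push_cast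
    field_simp
  have hint : Integrable (fun y => f (coords y)) := by
    have h1 : Integrable (fun y : EuclideanSpace ℝ (Fin 3) =>
        G.adjugate 0 0 * y 0 + G.adjugate 0 1 * y 1 + G.adjugate 0 2 * y 2)
        (multivariateGaussian 0 G) :=
      (((integrable_coord G 0).const_mul _).add ((integrable_coord G 1).const_mul _)).add
        ((integrable_coord G 2).const_mul _)
    rw [integrable_multivariateGaussian_iff hG] at h1
    simp_rw [hfy] at h1
    have := Real.sqrt_pos.2 hd
    exact (integrable_const_mul_iff (by simpa using ⟨this.ne', hc.ne'⟩) _).1 h1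
  have hint2 : Integrable f :=
    (measurePreserving_coords.integrable_comp_emb coords.measurableEmbedding).1 hint
  have hoct := integral_octant hA0 hA1 hA2 h12 hint2.integrableOn
  rw [← integral_indicator measurableSet_octant, integral_multivariateGaussian hG]
  have h2 (y : EuclideanSpace ℝ (Fin 3)) : gaussianDensity G y * octant.indicator (fun y =>
      G.adjugate 0 0 * y 0 + G.adjugate 0 1 * y 1 + G.adjugate 0 2 * y 2) y
      = octant.indicator (fun y => (√G.det * ((2 * Real.pi) ^ (3 / 2 : ℝ))⁻¹) * f (coords y)) y := by
    by_cases hy : y ∈ octant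
    · rw [Set.indicator_of_mem hy, Set.indicator_of_mem hy, hfy]
    · rw [Set.indicator_of_notMem hy, Set.indicator_of_notMem hy, mul_zero]
  simp_rw [h2]
  rw [integral_indicator measurableSet_octant, integral_const_mul, octant,
    measurePreserving_coords.setIntegral_preimage_emb coords.measurableEmbedding, hoct, hminor,
    hPe 1 2, hPe 1 1, hPe 2 2]
  have h3 : √(G.adjugate 1 1 / G.det * (G.adjugate 2 2 / G.det))
      = √(G.adjugate 1 1 * G.adjugate 2 2) / G.det := by
    rw [div_mul_div_comm, Real.sqrt_div' _ (by positivity), Real.sqrt_mul_self hd.le]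
  rw [h3, div_div_div_cancel_right₀ hd.ne', Real.sqrt_div hG0.le]
  nth_rewrite 3 [← Real.mul_self_sqrt hd.le]
  field_simp

/-- The matrix of the linear map `x ↦ (x i - x j, x i - x a, x i - x b)`. -/
def diffMatrix (i j a b : Fin 4) : Matrix (Fin 3) (Fin 4) ℝ :=
  Matrix.of fun r c => (if c = i then 1 else 0) - if c = ![j, a, b] r then 1 else 0

theorem diffMatrix_mulVec (i j a b : Fin 4) (x : Fin 4 → ℝ) (r : Fin 3) :
    (diffMatrix i j a b).mulVec x r = x i - x (![j, a, b] r) := by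
  simp [diffMatrix, Matrix.mulVec, dotProduct, sub_mul, Finset.sum_sub_distrib]

/-- The covariance matrix of `(X_i - X_j, X_i - X_a, X_i - X_b)`. -/
def diffCov (L : Matrix (Fin 4) (Fin 4) ℝ) (i j a b : Fin 4) : Matrix (Fin 3) (Fin 3) ℝ :=
  diffMatrix i j a b * L * (diffMatrix i j a b).conjTranspose

theorem diffCov_apply (L : Matrix (Fin 4) (Fin 4) ℝ) (i j a b : Fin 4) (r s : Fin 3) :
    diffCov L i j a b r s
      = L i i - L i (![j, a, b] s) - L (![j, a, b] r) i + L (![j, a, b] r) (![j, a, b] s) := by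
  rw [diffCov, Matrix.mul_assoc, Matrix.mul_apply']
  have h := diffMatrix_mulVec i j a b (fun p => (L * (diffMatrix i j a b).conjTranspose) p s) r
  rw [Matrix.mulVec] at h
  rw [h]
  have h' (p : Fin 4) : (L * (diffMatrix i j a b).conjTranspose) p s
      = L p i - L p (![j, a, b] s) := by
    have h := diffMatrix_mulVec i j a b (fun q => L p q) s
    rw [← h, Matrix.mul_apply, Matrix.mulVec, dotProduct]
    exact Finset.sum_congr rfl fun q _ => by
      rw [Matrix.conjTranspose_apply, star_trivial, mul_comm]
  rw [h', h']
  ring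

/-- The columns `j`, `a`, `b` of `diffMatrix` form minus the identity, so its rows are independent
and the congruence preserves positive definiteness. -/
theorem diffCov_posDef {L : Matrix (Fin 4) (Fin 4) ℝ} (hL : L.PosDef) {i j a b : Fin 4}
    (hij : i ≠ j) (hia : i ≠ a) (hib : i ≠ b) (hja : j ≠ a) (hjb : j ≠ b) (hab : a ≠ b) :
    (diffCov L i j a b).PosDef := by
  refine hL.mul_mul_conjTranspose_same ?_
  intro y z h
  have h1 (w : Fin 3 → ℝ) : Matrix.vecMul w (diffMatrix i j a b) j = -w 0 ∧
      Matrix.vecMul w (diffMatrix i j a b) a = -w 1 ∧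
      Matrix.vecMul w (diffMatrix i j a b) b = -w 2 := by
    simp [Matrix.vecMul, dotProduct, diffMatrix, Fin.sum_univ_three, hij.symm, hia.symm, hib.symm,
      hja, hja.symm, hjb, hjb.symm, hab, hab.symm]
  have h2 := h1 y
  simp only at h
  rw [h, (h1 z).1, (h1 z).2.1, (h1 z).2.2] at h2
  ext r
  fin_cases r
  · exact (neg_injective h2.1).symm
  · exact (neg_injective h2.2.1).symm
  · exact (neg_injective h2.2.2).symm

/-- The linear map `x ↦ (x i - x j, x i - x a, x i - x b)`. -/
def diffMap (i j a b : Fin 4) : EuclideanSpace ℝ (Fin 4) →L[ℝ] EuclideanSpace ℝ (Fin 3) :=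
  (Matrix.toEuclideanLin (diffMatrix i j a b)).toContinuousLinearMap

theorem diffMap_apply (i j a b : Fin 4) (x : EuclideanSpace ℝ (Fin 4)) (r : Fin 3) :
    diffMap i j a b x r = x i - x (![j, a, b] r) :=
  diffMatrix_mulVec i j a b x r

theorem map_diffMap {L : Matrix (Fin 4) (Fin 4) ℝ} (hL : L.PosDef) {i j a b : Fin 4}
    (hij : i ≠ j) (hia : i ≠ a) (hib : i ≠ b) (hja : j ≠ a) (hjb : j ≠ b) (hab : a ≠ b) :
    (law L).map (diffMap i j a b) = multivariateGaussian 0 (diffCov L i j a b) := by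
  refine map_eq_multivariateGaussian (diffCov_posDef hL hij hia hib hja hjb hab).posSemidef
    ⟨inferInstance⟩ (fun r => ?_) fun r s => ?_
  · simp_rw [diffMap_apply]
    rw [integral_sub (integrable_coord L _) (integrable_coord L _), integral_coord,
      integral_coord, sub_zero]
  · simp_rw [diffMap_apply]
    have hm := memLp_coord L
    have hms : MemLp (fun x : EuclideanSpace ℝ (Fin 4) => x i - x (![j, a, b] s)) 2 (law L) :=
      (hm _).sub (hm _)
    rw [covariance_fun_sub_left (hm _) (hm _) hms,
      covariance_fun_sub_right (hm _) (hm _) (hm _),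
      covariance_fun_sub_right (hm _) (hm _) (hm _), diffCov_apply]
    simp only [covariance_eval_multivariateGaussian hL.posSemidef]
    ring

/-- The set on which the `i`-th coordinate is larger than the `j`-th, `a`-th and `b`-th. -/
def winSet (i j a b : Fin 4) : Set (EuclideanSpace ℝ (Fin 4)) :=
  diffMap i j a b ⁻¹' octant

theorem mem_winSet {i j a b : Fin 4} {x : EuclideanSpace ℝ (Fin 4)} :
    x ∈ winSet i j a b ↔ x j < x i ∧ x a < x i ∧ x b < x i := by
  rw [winSet, Set.mem_preimage, mem_octant]
  simp only [diffMap_apply, sub_pos]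
  rfl

theorem measurableSet_winSet (i j a b : Fin 4) : MeasurableSet (winSet i j a b) :=
  (diffMap i j a b).continuous.measurable measurableSet_octant

/-- One linear equation for the three expected differences on the event that `i` wins; exchanging
the role of `j` with `a` or `b` supplies the other two. -/
theorem integral_winSet {L : Matrix (Fin 4) (Fin 4) ℝ} (hL : L.PosDef) {i j a b : Fin 4}
    (hij : i ≠ j) (hia : i ≠ a) (hib : i ≠ b) (hja : j ≠ a) (hjb : j ≠ b) (hab : a ≠ b) :
    let G := diffCov L i j a b
    G.adjugate 0 0 * (∫ x in winSet i j a b, (x i - x j) ∂law L) +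
      G.adjugate 0 1 * (∫ x in winSet i j a b, (x i - x a) ∂law L) +
      G.adjugate 0 2 * (∫ x in winSet i j a b, (x i - x b) ∂law L)
      = G.det * ((2 * Real.pi) ^ (3 / 2 : ℝ))⁻¹ *
        (Real.arccos (G.adjugate 1 2 / √(G.adjugate 1 1 * G.adjugate 2 2)) / √(G 0 0)) := by
  intro G
  have h := integral_octant_multivariateGaussian (diffCov_posDef hL hij hia hib hja hjb hab)
  rw [← map_diffMap hL hij hia hib hja hjb hab, setIntegral_map measurableSet_octant
    (by fun_prop) (by fun_prop)] at h
  rw [← h]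
  simp only [diffMap_apply]
  have hi (p q : Fin 4) : Integrable (fun x : EuclideanSpace ℝ (Fin 4) => x p - x q)
      ((law L).restrict (winSet i j a b)) :=
    ((integrable_coord L p).sub (integrable_coord L q)).restrict
  rw [← integral_const_mul, ← integral_const_mul, ← integral_const_mul, ← integral_add,
    ← integral_add]
  · rfl
  · exact ((hi _ _).const_mul _).add ((hi _ _).const_mul _)
  · exact (hi _ _).const_mul _
  · exact (hi _ _).const_mul _
  · exact (hi _ _).const_mul _

/-! ### A closed form of the expected maximum -/

/-- The polynomial `Λ̃_{ij}`, where `a` and `b` are the remaining two indices. -/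
def tildePoly (L : Matrix (Fin 4) (Fin 4) ℝ) (i j a b : Fin 4) : ℝ :=
  (1 - L i j + L i b - L j b) * (1 - L i j + L i a - L j a)
    - 2 * (1 - L i j) * (1 - L j a - L j b + L a b)

/-- The exterior dihedral angle at the edge `ij` of the tetrahedron with Gram matrix `L`. -/
def angle (L : Matrix (Fin 4) (Fin 4) ℝ) (i j a b : Fin 4) : ℝ :=
  Real.arccos (tildePoly L i j a b /
    √((1 - L i j) * (2 * gramDet L i j a b) + tildePoly L i j a b ^ 2))

section Fixed

variable {L : Matrix (Fin 4) (Fin 4) ℝ} {i j a b : Fin 4}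

theorem S.symm (hL : L ∈ S) (p q : Fin 4) : L p q = L q p := by
  simpa using congrFun₂ hL.1.1 q p

theorem gramDet_swap₁₂ (hs : ∀ p q, L p q = L q p) :
    gramDet L j i a b = gramDet L i j a b := by
  simp only [gramDet, hs j i, hs a i, hs b i, hs a j, hs b j, hs b a]; ring

theorem gramDet_swap₂₃ (hs : ∀ p q, L p q = L q p) :
    gramDet L i a j b = gramDet L i j a b := by
  simp only [gramDet, hs j i, hs a i, hs b i, hs a j, hs b j, hs b a]; ring

theorem gramDet_swap₃₄ (hs : ∀ p q, L p q = L q p) :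
    gramDet L i j b a = gramDet L i j a b := by
  simp only [gramDet, hs j i, hs a i, hs b i, hs a j, hs b j, hs b a]; ring

theorem tildePoly_swap (hs : ∀ p q, L p q = L q p) :
    tildePoly L j i a b = tildePoly L i j a b := by
  simp only [tildePoly, hs j i, hs a i, hs b i, hs a j, hs b j, hs b a]; ring

theorem tildePoly_swap' (hs : ∀ p q, L p q = L q p) :
    tildePoly L i j b a = tildePoly L i j a b := by
  simp only [tildePoly, hs j i, hs a i, hs b i, hs a j, hs b j, hs b a]; ring

theorem angle_swap (hs : ∀ p q, L p q = L q p) : angle L j i a b = angle L i j a b := by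
  rw [angle, tildePoly_swap hs, gramDet_swap₁₂ hs, hs j i, angle]

theorem angle_swap' (hs : ∀ p q, L p q = L q p) : angle L i j b a = angle L i j a b := by
  rw [angle, tildePoly_swap' hs, gramDet_swap₃₄ hs, angle]

theorem det_diffCov (hs : ∀ p q, L p q = L q p) :
    (diffCov L i j a b).det = gramDet L i j a b := by
  rw [Matrix.det_fin_three]
  simp only [diffCov_apply, Matrix.cons_val, gramDet, hs j i, hs a i, hs b i, hs a j, hs b j,
    hs b a]
  ring

theorem gramDet_pos (hL : L ∈ S)
    (hij : i ≠ j) (hia : i ≠ a) (hib : i ≠ b) (hja : j ≠ a) (hjb : j ≠ b) (hab : a ≠ b) :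
    0 < gramDet L i j a b := by
  rw [← det_diffCov (S.symm hL)]
  exact (diffCov_posDef hL.1 hij hia hib hja hjb hab).det_pos

theorem prime_pos (hL : L ∈ S)
    (hij : i ≠ j) (hia : i ≠ a) (hib : i ≠ b) (hja : j ≠ a) (hjb : j ≠ b) (hab : a ≠ b) :
    0 < 1 - L i j := by
  have h := (diffCov_posDef hL.1 hij hia hib hja hjb hab).diag_pos (i := 0)
  simp only [diffCov_apply, Matrix.cons_val, hL.2, S.symm hL j i] at h
  linarith

theorem integral_winSet_system (hL : L ∈ S)
    (hij : i ≠ j) (hia : i ≠ a) (hib : i ≠ b) (hja : j ≠ a) (hjb : j ≠ b) (hab : a ≠ b) :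
    let g := fun p q => 1 - L i p - L i q + L p q
    (g a a * g b b - g a b ^ 2) * (∫ x in winSet i j a b, (x i - x j) ∂law L) +
      (g a b * g j b - g j a * g b b) * (∫ x in winSet i j a b, (x i - x a) ∂law L) +
      (g j a * g a b - g a a * g j b) * (∫ x in winSet i j a b, (x i - x b) ∂law L)
      = gramDet L i j a b * (((2 * Real.pi) ^ (3 / 2 : ℝ))⁻¹ *
        (angle L i j a b / √(2 * (1 - L i j)))) := by
  intro g
  have h := integral_winSet hL.1 hij hia hib hja hjb hab
  have hs := S.symm hL
  have e0 : (diffCov L i j a b).adjugate 0 0 = g a a * g b b - g a b ^ 2 := by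
    rw [Matrix.adjugate_fin_three]
    simp only [diffCov_apply, Matrix.cons_val, Matrix.of_apply, Matrix.cons_val', hL.2,
      hs j i, hs a i, hs b i, hs a j, hs b j, hs b a, g]
    ring
  have e1 : (diffCov L i j a b).adjugate 0 1 = g a b * g j b - g j a * g b b := by
    rw [Matrix.adjugate_fin_three]
    simp only [diffCov_apply, Matrix.cons_val, Matrix.of_apply, Matrix.cons_val', hL.2,
      hs j i, hs a i, hs b i, hs a j, hs b j, hs b a, g]
    ring
  have e2 : (diffCov L i j a b).adjugate 0 2 = g j a * g a b - g a a * g j b := by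
    rw [Matrix.adjugate_fin_three]
    simp only [diffCov_apply, Matrix.cons_val, Matrix.of_apply, Matrix.cons_val', hL.2,
      hs j i, hs a i, hs b i, hs a j, hs b j, hs b a, g]
    ring
  have e3 : (diffCov L i j a b).adjugate 1 2 = tildePoly L i j a b := by
    rw [Matrix.adjugate_fin_three]
    simp only [diffCov_apply, Matrix.cons_val, Matrix.of_apply, Matrix.cons_val', hL.2,
      hs j i, hs a i, hs b i, hs a j, hs b j, hs b a, tildePoly]
    ring
  -- Jacobi's identity `adj₁₁ adj₂₂ - adj₁₂² = G₀₀ det G` with `G₀₀ = 2(1 - L i j)`; it turns the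
  -- quotient of cofactors into the argument of the arccosine in `angle`.
  have e4 : (diffCov L i j a b).adjugate 1 1 * (diffCov L i j a b).adjugate 2 2
      = (1 - L i j) * (2 * gramDet L i j a b) + tildePoly L i j a b ^ 2 := by
    rw [Matrix.adjugate_fin_three]
    simp only [diffCov_apply, Matrix.cons_val, Matrix.of_apply, Matrix.cons_val', hL.2,
      hs j i, hs a i, hs b i, hs a j, hs b j, hs b a, tildePoly, gramDet]
    ring
  have e5 : diffCov L i j a b 0 0 = 2 * (1 - L i j) := by
    simp only [diffCov_apply, Matrix.cons_val, hL.2, hs j i]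
    ring
  simp only [det_diffCov hs, e0, e1, e2, e3, e4, e5, mul_assoc] at h
  simpa only [angle, mul_assoc] using h

theorem winSet_swap₂₃ : winSet i a j b = winSet i j a b := by
  ext x; simp only [mem_winSet]; tauto

theorem winSet_swap₂₄ : winSet i b j a = winSet i j a b := by
  ext x; simp only [mem_winSet]; tauto

theorem integral_winSet_eq (hL : L ∈ S)
    (hij : i ≠ j) (hia : i ≠ a) (hib : i ≠ b) (hja : j ≠ a) (hjb : j ≠ b) (hab : a ≠ b) :
    ∫ x in winSet i j a b, (x i - x j) ∂law L = ((2 * Real.pi) ^ (3 / 2 : ℝ))⁻¹ *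
      (2 * (1 - L i j) * (angle L i j a b / √(2 * (1 - L i j)))
      + (1 - L i j - L i a + L j a) * (angle L i a j b / √(2 * (1 - L i a)))
      + (1 - L i j - L i b + L j b) * (angle L i b j a / √(2 * (1 - L i b)))) := by
  have h1 := integral_winSet_system hL hij hia hib hja hjb hab
  have h2 := integral_winSet_system hL hia hij hib hja.symm hab hjb
  have h3 := integral_winSet_system hL hib hij hia hjb.symm hab.symm hja
  have hs := S.symm hL
  rw [winSet_swap₂₃, gramDet_swap₂₃ hs] at h2
  rw [winSet_swap₂₄, gramDet_swap₂₃ hs, gramDet_swap₃₄ hs] at h3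
  have hd := gramDet_pos hL hij hia hib hja hjb hab
  apply mul_left_cancel₀ hd.ne'
  simp only [hL.2, hs a j, hs b j, hs b a] at h1 h2 h3
  have hg : gramDet L i j a b = (fun g : Fin 4 → Fin 4 → ℝ =>
      g j j * (g a a * g b b - g a b ^ 2) - g j a * (g j a * g b b - g a b * g j b)
        + g j b * (g j a * g a b - g a a * g j b)) (fun p q => 1 - L i p - L i q + L p q) := by
    simp only [gramDet, hL.2, hs j i, hs a i, hs b i, hs a j, hs b j, hs b a]; ring
  simp only [hL.2, hs a j, hs b j, hs b a] at hg
  have hh : gramDet L i j a b * ∫ x in winSet i j a b, (x i - x j) ∂law L =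
      (fun g : Fin 4 → Fin 4 → ℝ =>
      g j j * (g a a * g b b - g a b ^ 2) - g j a * (g j a * g b b - g a b * g j b)
        + g j b * (g j a * g a b - g a a * g j b)) (fun p q => 1 - L i p - L i q + L p q) *
        ∫ x in winSet i j a b, (x i - x j) ∂law L := by rw [hg]; simp only [hL.2]
  simp only [hL.2] at hh
  rw [hh]
  -- The equations have matrix `adj G`. The coefficients here are the first row of `G`, and `G · adj
  -- G = det G` isolates the first unknown.
  linear_combination (2 * (1 - L i j)) * h1 + (1 - L i j - L i a + L j a) * h2
    + (1 - L i j - L i b + L j b) * h3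

/-- The difference is a real Gaussian variable of positive variance, so it has no atom at `0`. -/
theorem ae_ne (hL : L ∈ S)
    (hij : i ≠ j) (hia : i ≠ a) (hib : i ≠ b) (hja : j ≠ a) (hjb : j ≠ b) (hab : a ≠ b) :
    ∀ᵐ x ∂law L, x i ≠ x j := by
  have hG := diffCov_posDef hL.1 hij hia hib hja hjb hab
  have h1 : MeasurePreserving (diffMap i j a b) (law L)
      (multivariateGaussian 0 (diffCov L i j a b)) :=
    ⟨by fun_prop, map_diffMap hL.1 hij hia hib hja hjb hab⟩
  have h2 := (measurePreserving_eval_multivariateGaussian (μ := 0) hG.posSemidef (i := 0)).comp h1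
  have hv : (diffCov L i j a b 0 0).toNNReal ≠ 0 := by
    simpa using hG.diag_pos (i := 0)
  have := nullSingletonClass_gaussianReal (μ := (0 : EuclideanSpace ℝ (Fin 3)) 0) hv
  have h3 : ∀ᵐ t ∂gaussianReal ((0 : EuclideanSpace ℝ (Fin 3)) 0)
      (diffCov L i j a b 0 0).toNNReal, t ≠ 0 := by
    rw [ae_iff]
    simp only [ne_eq, not_not]
    exact measure_singleton (0 : ℝ)
  filter_upwards [h2.quasiMeasurePreserving.ae h3] with x hx
  simpa [diffMap_apply, sub_eq_zero] using hx

theorem maxCoord_eq_of_forall_le {x : Fin 4 → ℝ} (h : ∀ p, x p ≤ x i) : maxCoord x = x i :=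
  le_antisymm (Finset.sup'_le _ _ fun p _ => h p) (Finset.le_sup' x (Finset.mem_univ i))

/-- When the coordinates are distinct, exactly one indicator is nonzero, that of the index attaining
the maximum. Removing the mean leaves only differences, whose integrals are known. -/
theorem maxCoord_sub_mean {x : EuclideanSpace ℝ (Fin 4)} (hij : i ≠ j) (hia : i ≠ a)
    (hib : i ≠ b) (hja : j ≠ a) (hjb : j ≠ b) (hab : a ≠ b)
    (xij : x i ≠ x j) (xia : x i ≠ x a) (xib : x i ≠ x b) (xja : x j ≠ x a) (xjb : x j ≠ x b)
    (xab : x a ≠ x b) :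
    maxCoord (fun p => x p) - (x i + x j + (x a + x b)) / 4
      = ((winSet i j a b).indicator (fun x => ((x i - x j) + (x i - x a) + (x i - x b)) / 4) x +
        (winSet j i a b).indicator (fun x => ((x j - x i) + (x j - x a) + (x j - x b)) / 4) x) +
        ((winSet a i j b).indicator (fun x => ((x a - x i) + (x a - x j) + (x a - x b)) / 4) x +
        (winSet b i j a).indicator (fun x => ((x b - x i) + (x b - x j) + (x b - x a)) / 4) x) := by
  have hp := eq_or_of_ne hij hia hib hja hjb hab
  obtain ⟨p, hpm⟩ := Finite.exists_max (fun p => x p)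
  rw [maxCoord_eq_of_forall_le hpm]
  have h1 := hpm i
  have h2 := hpm j
  have h3 := hpm a
  have h4 := hpm b
  rcases hp p with rfl | rfl | rfl | rfl
  · rw [Set.indicator_of_mem, Set.indicator_of_notMem, Set.indicator_of_notMem,
      Set.indicator_of_notMem]
    · ring
    all_goals simp only [mem_winSet]
    · exact fun h => h.1.not_ge h4
    · exact fun h => h.1.not_ge h3
    · exact fun h => h.1.not_ge h2
    · exact ⟨lt_of_le_of_ne h2 xij.symm, lt_of_le_of_ne h3 xia.symm, lt_of_le_of_ne h4 xib.symm⟩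
  · rw [Set.indicator_of_notMem, Set.indicator_of_mem, Set.indicator_of_notMem,
      Set.indicator_of_notMem]
    · ring
    all_goals simp only [mem_winSet]
    · exact fun h => h.2.1.not_ge h4
    · exact fun h => h.2.1.not_ge h3
    · exact ⟨lt_of_le_of_ne h1 xij, lt_of_le_of_ne h3 xja.symm, lt_of_le_of_ne h4 xjb.symm⟩
    · exact fun h => h.1.not_ge h1
  · rw [Set.indicator_of_notMem, Set.indicator_of_notMem, Set.indicator_of_mem,
      Set.indicator_of_notMem]
    · ring
    all_goals simp only [mem_winSet]
    · exact fun h => h.2.2.not_ge h4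
    · exact ⟨lt_of_le_of_ne h1 xia, lt_of_le_of_ne h2 xja, lt_of_le_of_ne h4 xab.symm⟩
    · exact fun h => h.2.1.not_ge h2
    · exact fun h => h.2.1.not_ge h1
  · rw [Set.indicator_of_notMem, Set.indicator_of_notMem, Set.indicator_of_notMem,
      Set.indicator_of_mem]
    · ring
    all_goals simp only [mem_winSet]
    · exact ⟨lt_of_le_of_ne h1 xib, lt_of_le_of_ne h2 xjb, lt_of_le_of_ne h3 xab⟩
    · exact fun h => h.2.2.not_ge h3
    · exact fun h => h.2.2.not_ge h2
    · exact fun h => h.2.2.not_ge h1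

theorem setIntegral_winSet_sum (hL : L ∈ S)
    (hij : i ≠ j) (hia : i ≠ a) (hib : i ≠ b) (hja : j ≠ a) (hjb : j ≠ b) (hab : a ≠ b) :
    ∫ x in winSet i j a b, ((x i - x j) + (x i - x a) + (x i - x b)) / 4 ∂law L
      = ((2 * Real.pi) ^ (3 / 2 : ℝ))⁻¹ / 4 *
      ((4 * (1 - L i j) + (L j a + L j b - L i a - L i b)) *
          (angle L i j a b / √(2 * (1 - L i j)))
      + (4 * (1 - L i a) + (L j a + L a b - L i j - L i b)) *
          (angle L i a j b / √(2 * (1 - L i a)))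
      + (4 * (1 - L i b) + (L j b + L a b - L i j - L i a)) *
          (angle L i b j a / √(2 * (1 - L i b)))) := by
  have hi (p q : Fin 4) : Integrable (fun x : EuclideanSpace ℝ (Fin 4) => x p - x q)
      ((law L).restrict (winSet i j a b)) :=
    ((integrable_coord L p).sub (integrable_coord L q)).restrict
  have h1 := integral_winSet_eq hL hij hia hib hja hjb hab
  have h2 := integral_winSet_eq hL hia hij hib hja.symm hab hjb
  have h3 := integral_winSet_eq hL hib hij hia hjb.symm hab.symm hja
  have hs := S.symm hL
  rw [winSet_swap₂₃] at h2
  rw [winSet_swap₂₄] at h3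
  have hsum : ∫ x in winSet i j a b, ((x i - x j) + (x i - x a) + (x i - x b)) / 4 ∂law L
      = ((∫ x in winSet i j a b, (x i - x j) ∂law L) + (∫ x in winSet i j a b, (x i - x a) ∂law L)
        + ∫ x in winSet i j a b, (x i - x b) ∂law L) / 4 := by
    rw [integral_div, ← integral_add (hi _ _) (hi _ _), ← integral_add _ (hi _ _)]
    exact (hi _ _).add (hi _ _)
  rw [hsum, h1, h2, h3, angle_swap' hs (i := i) (j := b) (a := j) (b := a),
    angle_swap' hs (i := i) (j := j) (a := a) (b := b),
    angle_swap' hs (i := i) (j := a) (a := j) (b := b), hs a j, hs b j, hs b a]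
  ring

theorem integral_add₄ {α : Type*} [MeasurableSpace α] {μ : Measure α} {f₁ f₂ f₃ f₄ : α → ℝ}
    (h₁ : Integrable f₁ μ) (h₂ : Integrable f₂ μ) (h₃ : Integrable f₃ μ) (h₄ : Integrable f₄ μ) :
    ∫ x, (f₁ x + f₂ x + (f₃ x + f₄ x)) ∂μ
      = (∫ x, f₁ x ∂μ) + (∫ x, f₂ x ∂μ) + ((∫ x, f₃ x ∂μ) + ∫ x, f₄ x ∂μ) := by
  rw [← integral_add h₁ h₂, ← integral_add h₃ h₄, ← integral_add]
  · exact h₁.add h₂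
  · exact h₃.add h₄

/-- Each edge receives a contribution from each of its two endpoints. The parts other than `4(1 - L
i j)` in the two coefficients are opposite and cancel, leaving the edge length as the weight. -/
theorem F_eq_sum_angle (hL : L ∈ S)
    (hij : i ≠ j) (hia : i ≠ a) (hib : i ≠ b) (hja : j ≠ a) (hjb : j ≠ b) (hab : a ≠ b) :
    F L = ((2 * Real.pi) ^ (3 / 2 : ℝ))⁻¹ *
      (√(2 * (1 - L i j)) * angle L i j a b + √(2 * (1 - L i a)) * angle L i a j b
      + √(2 * (1 - L i b)) * angle L i b j a + √(2 * (1 - L j a)) * angle L j a i b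
      + √(2 * (1 - L j b)) * angle L j b i a + √(2 * (1 - L a b)) * angle L a b i j) := by
  have hs := S.symm hL
  have hi := integrable_coord L
  have h1 := setIntegral_winSet_sum hL hij hia hib hja hjb hab
  have h2 := setIntegral_winSet_sum hL hij.symm hja hjb hia hib hab
  have h3 := setIntegral_winSet_sum hL hia.symm hja.symm hab hij hib hjb
  have h4 := setIntegral_winSet_sum hL hib.symm hjb.symm hab.symm hij hia hja
  have hint (p q r s : Fin 4) : Integrable ((winSet p q r s).indicator
      (fun x => ((x p - x q) + (x p - x r) + (x p - x s)) / 4)) (law L) :=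
    ((((hi p).sub (hi q)).add ((hi p).sub (hi r))).add ((hi p).sub (hi s))).div_const 4
      |>.indicator (measurableSet_winSet p q r s)
  have hmean : ∫ x, (x i + x j + (x a + x b)) / 4 ∂law L = 0 := by
    rw [integral_div, integral_add₄ (hi i) (hi j) (hi a) (hi b)]
    simp [integral_coord]
  have hmi : Integrable (fun x : EuclideanSpace ℝ (Fin 4) => (x i + x j + (x a + x b)) / 4)
      (law L) := (((hi i).add (hi j)).add ((hi a).add (hi b))).div_const 4
  have hae : ∀ᵐ x ∂law L, maxCoord (fun p => x p)
      = (((winSet i j a b).indicator (fun x => ((x i - x j) + (x i - x a) + (x i - x b)) / 4) x +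
        (winSet j i a b).indicator (fun x => ((x j - x i) + (x j - x a) + (x j - x b)) / 4) x) +
        ((winSet a i j b).indicator (fun x => ((x a - x i) + (x a - x j) + (x a - x b)) / 4) x +
        (winSet b i j a).indicator (fun x => ((x b - x i) + (x b - x j) + (x b - x a)) / 4) x))
        + (x i + x j + (x a + x b)) / 4 := by
    filter_upwards [ae_ne hL hij hia hib hja hjb hab, ae_ne hL hia hij hib hja.symm hab hjb,
      ae_ne hL hib hij hia hjb.symm hab.symm hja, ae_ne hL hja hij.symm hjb hia.symm hab hib,
      ae_ne hL hjb hij.symm hja hib.symm hab.symm hia,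
      ae_ne hL hab hia.symm hja.symm hib.symm hjb.symm hij] with x x1 x2 x3 x4 x5 x6
    rw [← maxCoord_sub_mean hij hia hib hja hjb hab x1 x2 x3 x4 x5 x6]
    ring
  have key := integral_add₄ (hint i j a b) (hint j i a b) (hint a i j b) (hint b i j a)
  rw [F, integral_congr_ae hae, integral_add (((hint i j a b).fun_add (hint j i a b)).fun_add
    ((hint a i j b).fun_add (hint b i j a))) hmi, hmean, key,
    integral_indicator (measurableSet_winSet _ _ _ _),
    integral_indicator (measurableSet_winSet _ _ _ _),
    integral_indicator (measurableSet_winSet _ _ _ _),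
    integral_indicator (measurableSet_winSet _ _ _ _), h1, h2, h3, h4]
  rw [hs j i, hs a i, hs b i, hs a j, hs b j, hs b a, angle_swap hs (i := i) (j := j),
    angle_swap hs (i := i) (j := a), angle_swap hs (i := i) (j := b),
    angle_swap hs (i := j) (j := a), angle_swap hs (i := j) (j := b),
    angle_swap hs (i := a) (j := b)]
  -- For `p ≤ 0` both sides are `0`, by the conventions for square roots and division, so no
  -- positivity of `p` is needed.
  have hk (p θ : ℝ) : √(2 * p) * θ = 2 * p * (θ / √(2 * p)) := by
    rcases le_or_gt p 0 with hp | hp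
    · rw [Real.sqrt_eq_zero'.2 (by linarith)]; simp
    · have : 0 < √(2 * p) := Real.sqrt_pos.2 (by linarith)
      have h2 : √(2 * p) * √(2 * p) = 2 * p := Real.mul_self_sqrt (by linarith)
      field_simp
      linear_combination θ * h2
  simp only [hk]
  ring

end Fixed

/-! ### Lines in `𝒮` -/

theorem dir_apply (k l p q : Fin 4) :
    dir k l p q = (if k = p ∧ l = q then 1 else 0) + (if l = p ∧ k = q then 1 else 0) := by
  simp [dir, Matrix.single_apply]

/-- Positivity of the quadratic form is an open condition at each point of the unit sphere;
compactness makes the range of `t` uniform, and scaling extends it to all nonzero vectors. -/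
theorem posDef_add_smul_eventually {L D : Matrix (Fin 4) (Fin 4) ℝ} (hL : L.PosDef)
    (hD : D.IsHermitian) : ∀ᶠ t in 𝓝 (0 : ℝ), (L + t • D).PosDef := by
  have hcont : Continuous fun z : ℝ × EuclideanSpace ℝ (Fin 4) =>
      z.2.ofLp ⬝ᵥ (L + z.1 • D).mulVec z.2.ofLp := by
    unfold dotProduct Matrix.mulVec dotProduct
    simp only [Matrix.add_apply, Matrix.smul_apply, smul_eq_mul]
    fun_prop
  have hpos : ∀ x ∈ Metric.sphere (0 : EuclideanSpace ℝ (Fin 4)) 1,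
      ∀ᶠ z : ℝ × EuclideanSpace ℝ (Fin 4) in 𝓝 (0, x),
        0 < z.2.ofLp ⬝ᵥ (L + z.1 • D).mulVec z.2.ofLp := by
    intro x hx
    refine hcont.continuousAt.eventually (lt_mem_nhds ?_)
    have hx0 : x.ofLp ≠ 0 := fun h => by
      have : x = 0 := by ext i; exact congrFun h i
      simp [this] at hx
    have := (Matrix.posDef_iff_dotProduct_mulVec.1 hL).2 hx0
    simpa using this
  filter_upwards [(isCompact_sphere _ _).eventually_forall_of_forall_eventually
    (P := fun (t : ℝ) (x : EuclideanSpace ℝ (Fin 4)) =>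
      0 < x.ofLp ⬝ᵥ (L + t • D).mulVec x.ofLp) hpos] with t ht
  refine Matrix.posDef_iff_dotProduct_mulVec.2 ⟨?_, fun x hx => ?_⟩
  · exact hL.1.add (hD.smul (IsSelfAdjoint.all t))
  · set v : EuclideanSpace ℝ (Fin 4) := WithLp.toLp 2 x
    have hv : v ≠ 0 := fun h => hx (by simpa [v] using congrArg WithLp.ofLp h)
    have hn : 0 < ‖v‖ := norm_pos_iff.2 hv
    have h := ht (‖v‖⁻¹ • v) (by simp [norm_smul, hn.ne'])
    simp only [WithLp.ofLp_smul, Matrix.mulVec_smul, dotProduct_smul, smul_dotProduct,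
      smul_eq_mul] at h
    rw [← mul_assoc] at h
    have h2 := pos_of_mul_pos_right h (by positivity)
    simpa [v] using h2

theorem add_smul_dir_mem_S {L : Matrix (Fin 4) (Fin 4) ℝ} (hL : L ∈ S) {k l : Fin 4}
    (hkl : k ≠ l) : ∀ᶠ t in 𝓝 (0 : ℝ), L + t • dir k l ∈ S := by
  have hD : (dir k l).IsHermitian := by
    ext p q
    simp only [Matrix.conjTranspose_apply, dir_apply, star_trivial]
    rw [add_comm]
    simp only [and_comm]
  filter_upwards [posDef_add_smul_eventually hL.1 hD] with t ht
  refine ⟨ht, fun i => ?_⟩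
  have : dir k l i i = 0 := by
    rw [dir_apply, if_neg, if_neg, add_zero]
    · rintro ⟨rfl, rfl⟩; exact hkl rfl
    · rintro ⟨rfl, rfl⟩; exact hkl rfl
  simp [hL.2, this]

/-! ### Derivatives of the dihedral angles -/

section Deriv

variable {M : ℝ → Matrix (Fin 4) (Fin 4) ℝ} {d : Matrix (Fin 4) (Fin 4) ℝ} {s : ℝ}

theorem hasDerivAt_tildePoly (h : ∀ p q, HasDerivAt (fun t => M t p q) (d p q) s)
    (i j a b : Fin 4) :
    HasDerivAt (fun t => tildePoly (M t) i j a b)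
      ((-d i j + d i b - d j b) * (1 - M s i j + M s i a - M s j a)
        + (1 - M s i j + M s i b - M s j b) * (-d i j + d i a - d j a)
        - (-2 * d i j * (1 - M s j a - M s j b + M s a b)
          + 2 * (1 - M s i j) * (-d j a - d j b + d a b))) s := by
  unfold tildePoly
  convert! ((((h i j).const_sub 1).add (h i b)).sub (h j b)).mul
    ((((h i j).const_sub 1).add (h i a)).sub (h j a)) |>.sub
    ((((h i j).const_sub 1).const_mul 2).mul
      ((((h j a).const_sub 1).sub (h j b)).add (h a b))) using 1
  simp only [Pi.add_apply, Pi.sub_apply]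
  ring

theorem hasDerivAt_gramDet (h : ∀ p q, HasDerivAt (fun t => M t p q) (d p q) s)
    (i j a b : Fin 4) :
    let g := fun p q => M s p q - M s p i - M s i q + M s i i
    let e := fun p q => d p q - d p i - d i q + d i i
    HasDerivAt (fun t => gramDet (M t) i j a b)
      (e j j * (g a a * g b b - g a b ^ 2) + e a a * (g j j * g b b - g b j ^ 2)
        + e b b * (g j j * g a a - g a j ^ 2)
        - 2 * e a b * (g j j * g a b - g a j * g b j)
        - 2 * e a j * (g a j * g b b - g a b * g b j)
        - 2 * e b j * (g a a * g b j - g a j * g a b)) s := by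
  intro g e
  have hg (p q : Fin 4) : HasDerivAt (fun t => M t p q - M t p i - M t i q + M t i i) (e p q) s :=
    (((h p q).sub (h p i)).sub (h i q)).add (h i i)
  unfold gramDet
  convert! (((hg j j).mul (((hg a a).mul (hg b b)).sub ((hg a b).pow 2))).sub
    ((hg a j).mul (((hg a j).mul (hg b b)).sub ((hg a b).mul (hg b j))))).add
    ((hg b j).mul (((hg a j).mul (hg a b)).sub ((hg a a).mul (hg b j)))) using 1
  simp [g]
  ring

/-- The derivative of `arccos (T / √(P * A + T ^ 2))`. -/
theorem hasDerivAt_arccos_div_sqrt {P T A : ℝ → ℝ} {P' T' A' : ℝ} (hP : HasDerivAt P P' s)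
    (hT : HasDerivAt T T' s) (hA : HasDerivAt A A' s) (hP0 : 0 < P s) (hA0 : 0 < A s) :
    HasDerivAt (fun t => Real.arccos (T t / √(P t * A t + T t ^ 2)))
      (-(P s * A s * T' - T s * (P' * A s + P s * A') / 2) /
        (√(P s) * √(A s) * (P s * A s + T s ^ 2))) s := by
  set Q := P s * A s + T s ^ 2 with hQ
  have hPA : 0 < P s * A s := by positivity
  have hQ0 : 0 < Q := by positivity
  have hr : 0 < √Q := Real.sqrt_pos.2 hQ0
  have hr2 : √Q ^ 2 = Q := Real.sq_sqrt hQ0.le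
  -- This is positive, so the argument stays strictly inside `(-1, 1)`, where the arccosine is
  -- differentiable.
  have h1 : 1 - (T s / √Q) ^ 2 = P s * A s / Q := by
    rw [div_pow, hr2, hQ]; field_simp; ring
  have hpos : 0 < P s * A s / Q := by positivity
  have hne1 : T s / √Q ≠ -1 := fun h => by rw [h] at h1; norm_num at h1; linarith
  have hne2 : T s / √Q ≠ 1 := fun h => by rw [h] at h1; norm_num at h1; linarith
  have hsq : HasDerivAt (fun t => √(P t * A t + T t ^ 2))
      ((P' * A s + P s * A' + 2 * T s * T') / (2 * √Q)) s := by
    have := ((hP.mul hA).add (hT.pow 2)).sqrt hQ0.ne'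
    convert! this using 2
    simp
  have hc := (Real.hasDerivAt_arccos hne1 hne2).comp s (hT.div hsq hr.ne')
  convert! hc using 1
  rw [h1, Real.sqrt_div hPA.le, Real.sqrt_mul hP0.le]
  have hp := Real.sqrt_pos.2 hP0
  have ha := Real.sqrt_pos.2 hA0
  change _ = -(1 / (√(P s) * √(A s) / √Q)) * ((T' * √Q - T s * ((P' * A s + P s * A' + 2 * T s * T')
    / (2 * √Q))) / √Q ^ 2)
  rw [hr2]
  field_simp
  rw [hr2, hQ]
  ring

end Deriv

/-- Four times the squared area of the face `klm`. -/
def face (L : Matrix (Fin 4) (Fin 4) ℝ) (k l m : Fin 4) : ℝ :=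
  4 * (1 - L k l) * (1 - L l m) - ((1 - L k l) + (1 - L l m) - (1 - L k m)) ^ 2

section Angles

variable {L : Matrix (Fin 4) (Fin 4) ℝ} {k l m n : Fin 4}

/-- By the symmetry of Heron's formula, `face` is a principal cofactor of the positive definite
matrix `diffCov`. -/
theorem face_pos (hL : L ∈ S) (hkl : k ≠ l) (hkm : k ≠ m) (hkn : k ≠ n) (hlm : l ≠ m)
    (hln : l ≠ n) (hmn : m ≠ n) : 0 < face L k l m := by
  have hG := diffCov_posDef hL.1 hkl hkm hkn hlm hln hmn
  have hs := S.symm hL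
  have h1 : 0 < (diffCov L k l m n)⁻¹ 2 2 := hG.inv.diag_pos
  rw [Matrix.inv_def, Matrix.smul_apply, Ring.inverse_eq_inv', smul_eq_mul] at h1
  have h2 := pos_of_mul_pos_right h1 (inv_pos.2 hG.det_pos).le
  rw [Matrix.adjugate_fin_three] at h2
  simp only [diffCov_apply, Matrix.cons_val, Matrix.of_apply, Matrix.cons_val', hL.2,
      hs l k, hs m k, hs n k, hs m l, hs n l, hs n m] at h2
  rw [face]
  linarith

/-- Jacobi's identity again, written with the areas of the two faces that meet at the edge `kl`. It
factors the denominator in the derivative of the angle. -/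
theorem face_mul_face (hL : L ∈ S) : (1 - L k l) * (2 * gramDet L k l m n)
    + tildePoly L k l m n ^ 2 = face L k l m * face L k l n := by
  have hs := S.symm hL
  simp only [face, gramDet, tildePoly, hL.2, hs l k, hs m k, hs n k, hs m l, hs n l, hs n m]
  ring

theorem hasDerivAt_add_smul_dir (L : Matrix (Fin 4) (Fin 4) ℝ) (r s p q : Fin 4) :
    HasDerivAt (fun t : ℝ => (L + t • dir r s) p q) (dir r s p q) 0 := by
  simpa using ((hasDerivAt_id (0 : ℝ)).mul_const (dir r s p q)).const_add (L p q)

theorem dir_comm (r s : Fin 4) : dir r s = dir s r := add_comm _ _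

/-- Write `P`, `T`, `A` for `1 - Λ_kl`, the tilde polynomial and twice the Gram determinant. Along
`Λ_mn` one has `P' = 0`, `T' = -2P` and `A' = 4T`, so the numerator is `2P(PA + T²)` and cancels the
factor `PA + T²`. -/
theorem hasDerivAt_angle_opposite (hL : L ∈ S) (hkl : k ≠ l) (hkm : k ≠ m) (hkn : k ≠ n)
    (hlm : l ≠ m) (hln : l ≠ n) (hmn : m ≠ n) :
    HasDerivAt (fun t : ℝ => angle (L + t • dir m n) k l m n)
      (2 * √(1 - L k l) / √(2 * gramDet L k l m n)) 0 := by
  have hs := S.symm hL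
  have hd := hasDerivAt_add_smul_dir L m n
  have hp := prime_pos hL hkl hkm hkn hlm hln hmn
  have hD := gramDet_pos hL hkl hkm hkn hlm hln hmn
  have hQ : 0 < (1 - L k l) * (2 * gramDet L k l m n) + tildePoly L k l m n ^ 2 := by positivity
  have h := hasDerivAt_arccos_div_sqrt ((hd k l).const_sub 1) (hasDerivAt_tildePoly hd k l m n)
    ((hasDerivAt_gramDet hd k l m n).const_mul 2) (by simpa using hp) (by simpa using hD)
  have hp' := Real.sqrt_pos.2 hp
  have hD' : 0 < √(2 * gramDet L k l m n) := Real.sqrt_pos.2 (by positivity)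
  have hp2 := Real.sq_sqrt hp.le
  simp only [angle]
  convert! h using 1
  simp only [zero_smul, add_zero]
  field_simp
  rw [hp2]
  simp only [gramDet, tildePoly, hL.2, hs l k, hs m k, hs n k, hs m l, hs n l, hs n m, dir_apply,
    hkl, hkl.symm, hkm, hkm.symm, hkn, hkn.symm, hlm, hlm.symm, hln, hln.symm, hmn, hmn.symm,
    and_true, and_false, and_self, if_true, if_false, reduceIte]
  ring

/-- The numerator is divisible by `face L k l n`, so only the face containing both edges remains in
the denominator. -/
theorem hasDerivAt_angle_adjacent (hL : L ∈ S) (hkl : k ≠ l) (hkm : k ≠ m) (hkn : k ≠ n)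
    (hlm : l ≠ m) (hln : l ≠ n) (hmn : m ≠ n) :
    HasDerivAt (fun t : ℝ => angle (L + t • dir k m) k l m n)
      (2 * √(1 - L k l) * tildePoly L l m k n / (√(2 * gramDet L k l m n) * face L k l m)) 0 := by
  have hs := S.symm hL
  have hd := hasDerivAt_add_smul_dir L k m
  have hp := prime_pos hL hkl hkm hkn hlm hln hmn
  have hD := gramDet_pos hL hkl hkm hkn hlm hln hmn
  have hN := face_pos hL hkl hkm hkn hlm hln hmn
  have hN' := face_pos hL hkl hkn hkm hln hlm hmn.symm
  have h := hasDerivAt_arccos_div_sqrt ((hd k l).const_sub 1) (hasDerivAt_tildePoly hd k l m n)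
    ((hasDerivAt_gramDet hd k l m n).const_mul 2) (by simpa using hp) (by simpa using hD)
  have hp' := Real.sqrt_pos.2 hp
  have hD' : 0 < √(2 * gramDet L k l m n) := Real.sqrt_pos.2 (by positivity)
  have hp2 := Real.sq_sqrt hp.le
  simp only [angle]
  convert! h using 1
  simp only [zero_smul, add_zero]
  rw [face_mul_face hL]
  field_simp
  rw [hp2]
  simp only [face, gramDet, tildePoly, hL.2, hs l k, hs m k, hs n k, hs m l, hs n l, hs n m,
    dir_apply,
    hkl, hkl.symm, hkm, hkm.symm, hkn, hkn.symm, hlm, hlm.symm, hln, hln.symm, hmn, hmn.symm,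
    and_true, and_false, and_self, if_true, if_false, reduceIte]
  ring

/-- Here the quotient by the product of the two faces splits into partial fractions, one term for
each face at the edge. -/
theorem hasDerivAt_angle_self (hL : L ∈ S) (hkl : k ≠ l) (hkm : k ≠ m) (hkn : k ≠ n)
    (hlm : l ≠ m) (hln : l ≠ n) (hmn : m ≠ n) :
    HasDerivAt (fun t : ℝ => angle (L + t • dir k l) k l m n)
      (-(tildePoly L k m l n * ((1 - L k l) + (1 - L l m) - (1 - L k m)) / face L k l m
        + tildePoly L k n l m * ((1 - L k l) + (1 - L l n) - (1 - L k n)) / face L k l n)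
        / (√(1 - L k l) * √(2 * gramDet L k l m n))) 0 := by
  have hs := S.symm hL
  have hd := hasDerivAt_add_smul_dir L k l
  have hp := prime_pos hL hkl hkm hkn hlm hln hmn
  have hD := gramDet_pos hL hkl hkm hkn hlm hln hmn
  have hN := face_pos hL hkl hkm hkn hlm hln hmn
  have hN' := face_pos hL hkl hkn hkm hln hlm hmn.symm
  have h := hasDerivAt_arccos_div_sqrt ((hd k l).const_sub 1) (hasDerivAt_tildePoly hd k l m n)
    ((hasDerivAt_gramDet hd k l m n).const_mul 2) (by simpa using hp) (by simpa using hD)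
  have hp' := Real.sqrt_pos.2 hp
  have hD' : 0 < √(2 * gramDet L k l m n) := Real.sqrt_pos.2 (by positivity)
  simp only [angle]
  convert! h using 1
  simp only [zero_smul, add_zero]
  rw [face_mul_face hL]
  field_simp
  simp only [face, gramDet, tildePoly, hL.2, hs l k, hs m k, hs n k, hs m l, hs n l, hs n m,
    dir_apply,
    hkl, hkl.symm, hkm, hkm.symm, hkn, hkn.symm, hlm, hlm.symm, hln, hln.symm, hmn, hmn.symm,
    and_true, and_false, and_self, if_true, if_false, reduceIte]
  ring

end Angles

/-! ### The Schläfli identity and the first-order derivatives -/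

section Main

variable {L : Matrix (Fin 4) (Fin 4) ℝ} {k l m n : Fin 4}

theorem tilde_eq (hL : L ∈ S) (hkl : k ≠ l) (hkm : k ≠ m) (hkn : k ≠ n)
    (hlm : l ≠ m) (hln : l ≠ n) (hmn : m ≠ n) : tilde L k l = tildePoly L k l m n := by
  have h : ∀ k l m n : Fin 4, k ≠ l → k ≠ m → k ≠ n → l ≠ m → l ≠ n → m ≠ n →
      (minRest k l = m ∧ maxRest k l = n) ∨ (minRest k l = n ∧ maxRest k l = m) := by
    decide
  rcases h k l m n hkl hkm hkn hlm hln hmn with ⟨h1, h2⟩ | ⟨h1, h2⟩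
  · simp only [tilde, h1, h2, tildePoly]
  · rw [← tildePoly_swap' (S.symm hL)]
    simp only [tilde, h1, h2, tildePoly]

/-- The Schläfli identity for the tetrahedron: the sum of the edge lengths, weighted by the
derivatives of the dihedral angles, vanishes. -/
theorem schlafli (hL : L ∈ S) (hkl : k ≠ l) (hkm : k ≠ m) (hkn : k ≠ n)
    (hlm : l ≠ m) (hln : l ≠ n) (hmn : m ≠ n) :
    -(tildePoly L k m l n * ((1 - L k l) + (1 - L l m) - (1 - L k m)) / face L k l m
        + tildePoly L k n l m * ((1 - L k l) + (1 - L l n) - (1 - L k n)) / face L k l n)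
      + 2 * (1 - L k m) * tildePoly L m l k n / face L k m l
      + 2 * (1 - L k n) * tildePoly L n l k m / face L k n l
      + 2 * (1 - L l m) * tildePoly L m k l n / face L l m k
      + 2 * (1 - L l n) * tildePoly L n k l m / face L l n k
      + 2 * (1 - L m n) = 0 := by
  have hs := S.symm hL
  have hN := face_pos hL hkl hkm hkn hlm hln hmn
  have hN' := face_pos hL hkl hkn hkm hln hlm hmn.symm
  -- Each summand is edge length times angle derivative, multiplied by `Ã/√2`. The area of a face
  -- does not depend on the order of its vertices, so only two denominators remain, those of the two
  -- faces containing the edge `kl`.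
  have e1 : face L k m l = face L k l m := by
    simp only [face, hs l k, hs m k, hs m l]; ring
  have e2 : face L k n l = face L k l n := by
    simp only [face, hs l k, hs n k, hs n l]; ring
  have e3 : face L l m k = face L k l m := by
    simp only [face, hs l k, hs m k, hs m l]; ring
  have e4 : face L l n k = face L k l n := by
    simp only [face, hs l k, hs n k, hs n l]; ring
  rw [e1, e2, e3, e4]
  field_simp
  simp only [face, tildePoly, hs l k, hs m k, hs n k, hs m l, hs n l, hs n m]
  ring

theorem two_pi_rpow : (2 * Real.pi) ^ (3 / 2 : ℝ) * √2 = 4 * √(Real.pi ^ 3) := by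
  have h : (2 * Real.pi) ^ (3 / 2 : ℝ) = √((2 * Real.pi) ^ 3) := by
    rw [Real.sqrt_eq_rpow, ← Real.rpow_natCast, ← Real.rpow_mul (by positivity)]
    norm_num
  rw [h, ← Real.sqrt_mul (by positivity), mul_pow]
  have : (2 : ℝ) ^ 3 * Real.pi ^ 3 * 2 = 4 ^ 2 * Real.pi ^ 3 := by ring
  rw [this, Real.sqrt_mul (by positivity), Real.sqrt_sq (by norm_num)]

/-- In the closed form only one length depends on `Λ_kl`, and the Schläfli identity removes all the
angle derivatives. -/
theorem hasDerivAt_F (hL : L ∈ S) (hkl : k ≠ l) (hkm : k ≠ m) (hkn : k ≠ n)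
    (hlm : l ≠ m) (hln : l ≠ n) (hmn : m ≠ n) :
    HasDerivAt (fun u : ℝ => F (L + u • dir k l))
      (-(1 / (4 * √(Real.pi ^ 3))) * (angle L k l m n / √(1 - L k l))) 0 := by
  have hs := S.symm hL
  have hev : (fun u : ℝ => F (L + u • dir k l)) =ᶠ[𝓝 0] fun u =>
      (fun M : Matrix (Fin 4) (Fin 4) ℝ => ((2 * Real.pi) ^ (3 / 2 : ℝ))⁻¹ *
      (√(2 * (1 - M k l)) * angle M k l m n + √(2 * (1 - M k m)) * angle M k m l n
      + √(2 * (1 - M k n)) * angle M k n l m + √(2 * (1 - M l m)) * angle M l m k n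
      + √(2 * (1 - M l n)) * angle M l n k m + √(2 * (1 - M m n)) * angle M m n k l))
      (L + u • dir k l) := by
    filter_upwards [add_smul_dir_mem_S hL hkl] with u hu
    exact F_eq_sum_angle hu hkl hkm hkn hlm hln hmn
  refine HasDerivAt.congr_of_eventuallyEq ?_ hev
  have hp1 := prime_pos hL hkl hkm hkn hlm hln hmn
  have hp2 := prime_pos hL hkm hkl hkn hlm.symm hmn hln
  have hp3 := prime_pos hL hkn hkl hkm hln.symm hmn.symm hlm
  have hp4 := prime_pos hL hlm hkl.symm hln hkm.symm hmn hkn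
  have hp5 := prime_pos hL hln hkl.symm hlm hkn.symm hmn.symm hkm
  have hp6 := prime_pos hL hmn hkm.symm hlm.symm hkn.symm hln.symm hkl
  have h1 := hasDerivAt_angle_self hL hkl hkm hkn hlm hln hmn
  have h2 := hasDerivAt_angle_adjacent hL hkm hkl hkn hlm.symm hmn hln
  have h3 := hasDerivAt_angle_adjacent hL hkn hkl hkm hln.symm hmn.symm hlm
  have h4 := hasDerivAt_angle_adjacent hL hlm hkl.symm hln hkm.symm hmn hkn
  have h5 := hasDerivAt_angle_adjacent hL hln hkl.symm hlm hkn.symm hmn.symm hkm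
  have h6 := hasDerivAt_angle_opposite hL hmn hkm.symm hlm.symm hkn.symm hln.symm hkl
  have hA := Atilde_eq hL.1.posSemidef hkl hkm hkn hlm hln hmn
  rw [← hA] at h1
  rw [← Atilde_eq hL.1.posSemidef hkm hkl hkn hlm.symm hmn hln] at h2
  rw [← Atilde_eq hL.1.posSemidef hkn hkl hkm hln.symm hmn.symm hlm] at h3
  rw [← Atilde_eq hL.1.posSemidef hlm hkl.symm hln hkm.symm hmn hkn, dir_comm l k] at h4
  rw [← Atilde_eq hL.1.posSemidef hln hkl.symm hlm hkn.symm hmn.symm hkm, dir_comm l k] at h5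
  rw [← Atilde_eq hL.1.posSemidef hmn hkm.symm hlm.symm hkn.symm hln.symm hkl] at h6
  have hA0 : 0 < Atilde L := by
    have := gramDet_pos hL hkl hkm hkn hlm hln hmn
    rw [hA]; positivity
  have hd := hasDerivAt_add_smul_dir L k l
  have hr (p q : Fin 4) (hpq : 0 < 1 - L p q) := (((hd p q).const_sub 1).const_mul 2).sqrt
    (by simpa using hpq.ne')
  have hsum := ((((((hr k l hp1).mul h1).add ((hr k m hp2).mul h2)).add ((hr k n hp3).mul h3)).add
    ((hr l m hp4).mul h4)).add ((hr l n hp5).mul h5)).add ((hr m n hp6).mul h6)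
  convert! hsum.const_mul (((2 * Real.pi) ^ (3 / 2 : ℝ))⁻¹) using 1
  have hsch := schlafli hL hkl hkm hkn hlm hln hmn
  have z (p q : Fin 4) : √(2 * (1 - L p q)) = √2 * √(1 - L p q) := Real.sqrt_mul (by norm_num) _
  simp only [dir_apply, zero_smul, add_zero, z,
    hkl, hkl.symm, hkm, hkm.symm, hkn, hkn.symm, hlm, hlm.symm, hln, hln.symm, hmn, hmn.symm,
    and_true, and_false, and_self, if_true, if_false, reduceIte]
  have q1 := Real.sqrt_pos.2 hp1
  have q2 := Real.sq_sqrt hp2.le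
  have q3 := Real.sq_sqrt hp3.le
  have q4 := Real.sq_sqrt hp4.le
  have q5 := Real.sq_sqrt hp5.le
  have q6 := Real.sq_sqrt hp6.le
  have q7 : √(1 - L k l) * (√(1 - L k l))⁻¹ = 1 := mul_inv_cancel₀ q1.ne'
  have h22 : √2 * √2 = (2 : ℝ) := Real.mul_self_sqrt (by norm_num)
  have h20 : √2 * (√2)⁻¹ = (1 : ℝ) := mul_inv_cancel₀ (by positivity)
  have hc : ((2 * Real.pi) ^ (3 / 2 : ℝ))⁻¹ = √2 * (1 / (4 * √(Real.pi ^ 3))) := by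
    rw [← two_pi_rpow]
    have : (0 : ℝ) < (2 * Real.pi) ^ (3 / 2 : ℝ) := by positivity
    field_simp
  rw [hc]
  set c := 1 / (4 * √(Real.pi ^ 3))
  set N := tildePoly L k m l n * ((1 - L k l) + (1 - L l m) - (1 - L k m)) / face L k l m
        + tildePoly L k n l m * ((1 - L k l) + (1 - L l n) - (1 - L k n)) / face L k l n
  set A := Atilde L
  -- `h20` treats the surviving length term, `h22` and `q2` to `q7` simplify the products of square
  -- roots, and `hsch` cancels the angle terms.
  linear_combination (c * (√(1 - L k l))⁻¹ * angle L k l m n) * h20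
    + c * (√(1 - L k l) * (√(1 - L k l))⁻¹ * A⁻¹ * N
      - √(1 - L k m) ^ 2 * 2 * tildePoly L m l k n * A⁻¹ * (face L k m l)⁻¹
      - √(1 - L k n) ^ 2 * 2 * tildePoly L n l k m * A⁻¹ * (face L k n l)⁻¹
      - √(1 - L l m) ^ 2 * 2 * tildePoly L m k l n * A⁻¹ * (face L l m k)⁻¹
      - √(1 - L l n) ^ 2 * 2 * tildePoly L n k l m * A⁻¹ * (face L l n k)⁻¹
      - √(1 - L m n) ^ 2 * 2 * A⁻¹) * h22
    + 2 * c * A⁻¹ * N * q7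
    - 4 * c * tildePoly L m l k n * A⁻¹ * (face L k m l)⁻¹ * q2
    - 4 * c * tildePoly L n l k m * A⁻¹ * (face L k n l)⁻¹ * q3
    - 4 * c * tildePoly L m k l n * A⁻¹ * (face L l m k)⁻¹ * q4
    - 4 * c * tildePoly L n k l m * A⁻¹ * (face L l n k)⁻¹ * q5
    - 4 * c * A⁻¹ * q6 - 2 * c * A⁻¹ * hsch

theorem partialDeriv_F (hL : L ∈ S) (hkl : k ≠ l) (hkm : k ≠ m) (hkn : k ≠ n)
    (hlm : l ≠ m) (hln : l ≠ n) (hmn : m ≠ n) :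
    partialDeriv F k l L = -(1 / (4 * √(Real.pi ^ 3))) * (angle L k l m n / √(1 - L k l)) :=
  (hasDerivAt_F hL hkl hkm hkn hlm hln hmn).deriv

/-- Since `S` is open along coordinate directions, the formula for the first derivative holds near
`t = 0` and may itself be differentiated. -/
theorem hasSecondPartial_F (hL : L ∈ S) (hkl : k ≠ l) (hkm : k ≠ m) (hkn : k ≠ n)
    (hlm : l ≠ m) (hln : l ≠ n) (hmn : m ≠ n) {p q : Fin 4} (hpq : p ≠ q) {v : ℝ}
    (h : HasDerivAt (fun t : ℝ => -(1 / (4 * √(Real.pi ^ 3))) *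
      (angle (L + t • dir p q) k l m n / √(1 - (L + t • dir p q) k l))) v 0) :
    HasSecondPartial F k l p q v L := by
  have hS := add_smul_dir_mem_S hL hpq
  refine ⟨?_, h.congr_of_eventuallyEq ?_⟩
  · filter_upwards [hS] with t ht
    exact (hasDerivAt_F ht hkl hkm hkn hlm hln hmn).differentiableAt
  · filter_upwards [hS] with t ht
    exact partialDeriv_F ht hkl hkm hkn hlm hln hmn

end Main

end GaussianMax

end

/-! ### The second-order derivatives -/

theorem mainTheorem6 (L : Matrix (Fin 4) (Fin 4) ℝ) (hL : L ∈ GaussianMax.S)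
    (k l m n : Fin 4) (hkl : k ≠ l) (hkm : k ≠ m) (hkn : k ≠ n)
    (hlm : l ≠ m) (hln : l ≠ n) (hmn : m ≠ n) :
    GaussianMax.HasSecondPartial GaussianMax.F k l k l
      (-(1 / (8 * √(Real.pi ^ 3 * GaussianMax.prime L k l ^ 3))) *
          Real.arccos (GaussianMax.tilde L k l /
            √(GaussianMax.prime L k l * GaussianMax.Atilde L ^ 2 + GaussianMax.tilde L k l ^ 2))
        + 1 / (4 * √(Real.pi ^ 3) * GaussianMax.prime L k l * GaussianMax.Atilde L) *
          (GaussianMax.tilde L k m *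
              (GaussianMax.prime L k l + GaussianMax.prime L l m - GaussianMax.prime L k m) /
              (4 * GaussianMax.prime L k l * GaussianMax.prime L l m -
                (GaussianMax.prime L k l + GaussianMax.prime L l m
                  - GaussianMax.prime L k m) ^ 2)
            + GaussianMax.tilde L k n *
              (GaussianMax.prime L k l + GaussianMax.prime L l n - GaussianMax.prime L k n) /
              (4 * GaussianMax.prime L k l * GaussianMax.prime L l n -
                (GaussianMax.prime L k l + GaussianMax.prime L l n
                  - GaussianMax.prime L k n) ^ 2))) L ∧
    GaussianMax.HasSecondPartial GaussianMax.F k l k m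
      (-(GaussianMax.tilde L l m /
          (2 * √(Real.pi ^ 3) * GaussianMax.Atilde L *
            (4 * GaussianMax.prime L k l * GaussianMax.prime L l m -
              (GaussianMax.prime L k l + GaussianMax.prime L l m
                - GaussianMax.prime L k m) ^ 2)))) L ∧
    GaussianMax.HasSecondPartial GaussianMax.F k l m n
      (-(1 / (2 * √(Real.pi ^ 3) * GaussianMax.Atilde L))) L := by
  open GaussianMax in
  have hp := prime_pos hL hkl hkm hkn hlm hln hmn
  have hD := gramDet_pos hL hkl hkm hkn hlm hln hmn
  have hA := Atilde_eq hL.1.posSemidef hkl hkm hkn hlm hln hmn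
  have hA0 : 0 < Atilde L := by rw [hA]; positivity
  have hA2 : Atilde L ^ 2 = 2 * gramDet L k l m n := by rw [hA, Real.sq_sqrt (by positivity)]
  have hN := face_pos hL hkl hkm hkn hlm hln hmn
  have hN' := face_pos hL hkl hkn hkm hln hlm hmn.symm
  have hr := Real.sqrt_pos.2 hp
  have hr2 := Real.sq_sqrt hp.le
  have hpi : 0 < √(Real.pi ^ 3) := by positivity
  have hface (x : Fin 4) : 4 * prime L k l * prime L l x -
      (prime L k l + prime L l x - prime L k x) ^ 2 = face L k l x := rfl
  rw [hface m, hface n, hA2, tilde_eq hL hkl hkm hkn hlm hln hmn,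
    tilde_eq hL hkm hkl hkn hlm.symm hmn hln, tilde_eq hL hkn hkl hkm hln.symm hmn.symm hlm,
    tilde_eq hL hlm hkl.symm hln hkm.symm hmn hkn]
  refine ⟨hasSecondPartial_F hL hkl hkm hkn hlm hln hmn hkl ?_,
    hasSecondPartial_F hL hkl hkm hkn hlm hln hmn hkm ?_,
    hasSecondPartial_F hL hkl hkm hkn hlm hln hmn hmn ?_⟩
  · have h1 := hasDerivAt_angle_self hL hkl hkm hkn hlm hln hmn
    rw [← hA] at h1
    have h2 := ((hasDerivAt_add_smul_dir L k l k l).const_sub 1).sqrt (by simpa using hp.ne')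
    have h3 := (h1.div h2 (by simpa using hr.ne')).const_mul (-(1 / (4 * √(Real.pi ^ 3))))
    convert! h3 using 1
    have e : √(Real.pi ^ 3 * prime L k l ^ 3) = √(Real.pi ^ 3) * ((1 - L k l) * √(1 - L k l)) := by
      rw [Real.sqrt_mul (by positivity), prime, show (1 - L k l) ^ 3
        = (1 - L k l) ^ 2 * (1 - L k l) by ring, Real.sqrt_mul (by positivity),
        Real.sqrt_sq hp.le]
    rw [e]
    simp only [dir_apply, zero_smul, add_zero, hkl, hkl.symm, and_true, and_false, and_self,
      if_true, if_false, reduceIte, prime, angle, hr2]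
    generalize Real.arccos _ = θ
    generalize tildePoly L k m l n * _ / _ + _ = N
    field_simp
    ring
  · have h1 := (hasDerivAt_angle_adjacent hL hkl hkm hkn hlm hln hmn).div_const √(1 - L k l)
    rw [← hA] at h1
    have h3 := h1.const_mul (-(1 / (4 * √(Real.pi ^ 3))))
    convert! h3 using 1
    -- `Λ_kl` is constant in the direction `km`, so the factor `√(1 - Λ_kl)` is not differentiated.
    · simp [dir_apply, hkl, hlm.symm, hkm.symm]
    · field_simp
      ring
  · have h1 := (hasDerivAt_angle_opposite hL hkl hkm hkn hlm hln hmn).div_const √(1 - L k l)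
    rw [← hA] at h1
    have h3 := h1.const_mul (-(1 / (4 * √(Real.pi ^ 3))))
    convert! h3 using 1
    · simp [dir_apply, hkm.symm, hlm.symm, hkn.symm, hln.symm]
    · field_simp
      ring
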